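/- Let $V=\bigoplus_{k\ge 0}V_k$ be a vertex operator algebra over $\mathbb{C}$ with finite-dimensional weight spaces, $V_0=\mathbb{C}\mathbf 1\neq 0$, vertex operators $Y(a,z)=\sum_{n\in\mathbb Z}a_nz^{-n-1}$, conformal vector $\omega\in V_2$, Virasoro modes $L_n=\omega_{n+1}$ and central charge $C$. Assume that $V_1=0$ and that $V$ carries a Li--Zamolodchikov metric: a symmetric nondegenerate bilinear form $\langle\,,\rangle$ on $V$ with $\langle\mathbf 1,\mathbf 1\rangle=1$ and $$\langle Y(e^{zL_1}(-z^{-2})^{L_0}c,z^{-1})a,b\rangle=\langle a,Y(c,z)b\rangle\qquad(a,b,c\in V).$$ Let $P_2=\{a\in V_2: L_na=0 \text{ for all } n>0\}$ be the space of primary vectors of weight $2$, $p_2=\dim P_2$, let $\{u_\alpha\}$ be a basis of $P_2$ and $\{u^\alpha\}$ the dual basis, $\langle u^\alpha,u_\beta\rangle=\delta^\alpha_\beta$. Put $$\lambda^{(4)}=\sum_\alpha u^\alpha_{-1}u_\alpha\in V_4,\qquad F(a,b;x,y)=\sum_\alpha\langle a,Y(u^\alpha,x)Y(u_\alpha,y)b\rangle\quad(a,b\in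 P_2),$$ and let $V_4(C,0)\subseteq V_4$ be the space of weight $4$ Virasoro descendants of the vacuum, i.e. the span of the vectors $L_{-i_1}\cdots L_{-i_s}\mathbf 1$ with $i_j\ge1$ and $i_1+\dots+i_s=4$. Suppose $\lambda^{(4)}\in V_4(C,0)$ and $C\neq 0,-\tfrac{22}{5}$. Then for all $a,b\in P_2$ the series $F(a,b;x,y)$ is the expansion in the domain $|x|>|y|$, that is in $\mathbb{C}((x))((y))$, of the rational function $$\frac{G(a,b;x,y)}{x^4y^4(x-y)^4},$$ where $$G(a,b;x,y)=\langle a,b\rangle\Big[p_2x^4y^4+\frac{8p_2}{C}x^3y^3(x-y)^2+\frac{4p_2(44-C)}{C(5C+22)}x^2y^2(x-y)^4+2(x^2+y^2)(x-y)^6-(x-y)^8\Big].$$ Moreover, for all $a,b\in V_2$, with $a\bullet b=a_1b\in V_2$ and the zero mode $o(c)=c_1:V_2\to V_2$ for $c\in V_2$, $$\mathrm{Tr}_{V_2}\,o(a\bullet b)=\frac{8(p_2+1)}{C}\langle a,b\rangle .$$ -/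

import Mathlib

open scoped BigOperators

noncomputable section

/-- A vertex operator algebra over `ℂ`, with grading `V = ⨁_{k ≥ 0} V_k`, `V_0 = ℂ𝟏`.
`VertexOperator.ncoeff (Y a) n` is the mode `a_n` in `Y(a, z) = ∑ a_n z^{-n-1}`. -/
structure VertexOperatorAlgebra (V : Type*) [AddCommGroup V] [Module ℂ V] where
  /-- the weight spaces `V_k` (zero for `k < 0`) -/
  gr : ℤ → Submodule ℂ V
  isInternal : DirectSum.IsInternal gr
  gr_neg : ∀ k : ℤ, k < 0 → gr k = ⊥
  finiteDimensional : ∀ k : ℤ, FiniteDimensional ℂ (gr k)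
  /-- the vacuum vector `𝟏` -/
  vac : V
  vac_ne_zero : vac ≠ 0
  gr_zero : gr 0 = Submodule.span ℂ {vac}
  /-- the state-field correspondence -/
  Y : V →ₗ[ℂ] VertexOperator ℂ V
  /-- `Y(a, z)` is homogeneous: `a_n` has weight `k - n - 1` for `a ∈ V_k` -/
  mode_mem : ∀ {k l : ℤ} {a b : V}, a ∈ gr k → b ∈ gr l → ∀ n : ℤ,
    VertexOperator.ncoeff (Y a) n b ∈ gr (k + l - n - 1)
  /-- `Y(𝟏, z) = id` -/
  vac_mode : ∀ (n : ℤ) (b : V),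
    VertexOperator.ncoeff (Y vac) n b = if n = -1 then b else 0
  /-- `Y(a, z)𝟏 ∈ a + z V[[z]]` -/
  mode_vac : ∀ a : V, VertexOperator.ncoeff (Y a) (-1) vac = a
  mode_vac_of_nonneg : ∀ (a : V) (n : ℤ), 0 ≤ n → VertexOperator.ncoeff (Y a) n vac = 0
  /-- mutual locality: `(x - y)^N [Y(a, x), Y(b, y)] = 0` for some `N`,
  written as the vanishing of the coefficient of each `x^{-m-1} y^{-n-1}` -/
  locality : ∀ a b : V, ∃ N : ℕ, ∀ (m n : ℤ) (v : V),
    ∑ i ∈ Finset.range (N + 1), ((-1 : ℂ) ^ i * (N.choose i : ℂ)) •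
      (VertexOperator.ncoeff (Y a) (m + N - i) (VertexOperator.ncoeff (Y b) (n + i) v)
        - VertexOperator.ncoeff (Y b) (n + i) (VertexOperator.ncoeff (Y a) (m + N - i) v)) = 0
  /-- the central charge `C` -/
  charge : ℂ
  /-- the conformal vector `ω`, with `Y(ω, z) = ∑ L_n z^{-n-2}`, i.e. `L_n = ω_{n+1}` -/
  conf : V
  conf_mem : conf ∈ gr 2
  virasoro : ∀ (m n : ℤ) (v : V),
    VertexOperator.ncoeff (Y conf) (m + 1) (VertexOperator.ncoeff (Y conf) (n + 1) v)
      - VertexOperator.ncoeff (Y conf) (n + 1) (VertexOperator.ncoeff (Y conf) (m + 1) v)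
      = ((m : ℂ) - n) • VertexOperator.ncoeff (Y conf) (m + n + 1) v
        + (if m + n = 0 then ((m : ℂ) ^ 3 - m) / 12 * charge else 0) • v
  /-- `L_0` acts on `V_k` as multiplication by `k` -/
  weight : ∀ (k : ℤ) (a : V), a ∈ gr k →
    VertexOperator.ncoeff (Y conf) 1 a = (k : ℂ) • a
  /-- `Y(L_{-1} a, z) = ∂_z Y(a, z)` -/
  translation : ∀ (a : V) (n : ℤ) (v : V),
    VertexOperator.ncoeff (Y (VertexOperator.ncoeff (Y conf) 0 a)) n v
      = (-(n : ℂ)) • VertexOperator.ncoeff (Y a) (n - 1) v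

namespace VertexOperatorAlgebra

variable {V : Type*} [AddCommGroup V] [Module ℂ V] (A : VertexOperatorAlgebra V)

/-- The mode `a_n`. -/
def mode (a : V) (n : ℤ) : Module.End ℂ V := VertexOperator.ncoeff (A.Y a) n

/-- The Virasoro operator `L_n = ω_{n+1}`. -/
def L (n : ℤ) : Module.End ℂ V := A.mode A.conf (n + 1)

/-- The space `P_k` of primary vectors of weight `k`: those `a ∈ V_k` with `L_n a = 0`
for all `n > 0`. -/
def primary (k : ℤ) : Submodule ℂ V :=
  A.gr k ⊓ ⨅ (n : ℤ) (_ : 0 < n), LinearMap.ker (A.L n)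

/-- `V_n(C, 0)`, the Virasoro descendants of the vacuum of weight `n`: the span of all
`L_{-i₁} ⋯ L_{-iₛ} 𝟏` with all `iⱼ ≥ 1` and `i₁ + ⋯ + iₛ = n`. -/
def vacDescendants (n : ℕ) : Submodule ℂ V :=
  Submodule.span ℂ {v | ∃ l : List ℕ, (∀ i ∈ l, 1 ≤ i) ∧ l.sum = n ∧
    v = l.foldr (fun i w => A.L (-(i : ℤ)) w) A.vac}

/-- A Li-Zamolodchikov metric: a symmetric nondegenerate bilinear form with `⟨𝟏, 𝟏⟩ = 1` and
`⟨Y(e^{z L_1} (-z^{-2})^{L_0} c, z^{-1}) a, b⟩ = ⟨a, Y(c, z) b⟩`. The last identity is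
written for `c ∈ V_k` and as equality of the coefficients of each `z^{-n-1}`; the sum over
`j` comes from `e^{z L_1}`, where `L_1^j c = 0` for `j > k`. -/
structure IsLiZMetric (B : LinearMap.BilinForm ℂ V) : Prop where
  symm : ∀ a b : V, B a b = B b a
  nondegenerate : ∀ a : V, (∀ b : V, B a b = 0) → a = 0
  vac_vac : B A.vac A.vac = 1
  invariant : ∀ (k : ℕ) (c : V), c ∈ A.gr k → ∀ (n : ℤ) (a b : V),
    ∑ j ∈ Finset.range (k + 1), ((-1 : ℂ) ^ k / (j.factorial : ℂ)) *
        B (A.mode (((A.L 1) ^ j) c) (2 * (k : ℤ) - j - n - 2) a) b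
      = B a (A.mode c n b)

/-- The Griess product `a • b = a_1 b` on `V_2`. -/
def griess (a b : A.gr 2) : A.gr 2 :=
  ⟨A.mode a 1 b, by simpa [mode] using A.mode_mem a.2 b.2 1⟩

/-- The zero mode `o(a) = a_{k-1} : V_l → V_l` of `a ∈ V_k`. -/
def zeroMode {k : ℤ} (l : ℤ) (a : A.gr k) : Module.End ℂ (A.gr l) :=
  (A.mode a (k - 1)).restrict (fun b hb => by
    have h := A.mode_mem a.2 hb (k - 1)
    have e : k + l - (k - 1) - 1 = l := by ring
    rwa [e] at h)

/-- The Casimir vector `λ^{(n)} = ∑_α u^α_{3-n} u_α`, for a basis `u` of `P_2` and a dual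
basis `u'`. -/
def casimir {ι : Type*} [Fintype ι] (u u' : ι → V) (n : ℤ) : V :=
  ∑ α, A.mode (u' α) (3 - n) (u α)

/-- The formal series `⟨a, Y(c, x) Y(d, y) b⟩ = ∑ ⟨a, c_m d_n b⟩ x^{-m-1} y^{-n-1}`, an
element of `ℂ((x))((y))`: the outer variable is `y` and the inner one is `x`. -/
def twoPoint (B : LinearMap.BilinForm ℂ V) (a c d b : V) : LaurentSeries (LaurentSeries ℂ) :=
  (HVertexOperator.compHahnSeries (A.Y c) (A.Y d) b).map
    (⟨fun s => s.map (B a), by ext; simp⟩ : ZeroHom (HahnSeries ℤ V) (HahnSeries ℤ ℂ))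

theorem twoPoint_coeff (B : LinearMap.BilinForm ℂ V) (a c d b : V) (m n : ℤ) :
    ((A.twoPoint B a c d b).coeff (-n - 1)).coeff (-m - 1) = B a (A.mode c m (A.mode d n b)) :=
  rfl

/-- The correlation function `F(a, b; x, y) = ∑_α ⟨a, Y(u^α, x) Y(u_α, y) b⟩`. -/
def correlation (B : LinearMap.BilinForm ℂ V) {ι : Type*} [Fintype ι] (u u' : ι → V)
    (a b : V) : LaurentSeries (LaurentSeries ℂ) :=
  ∑ α, A.twoPoint B a (u' α) (u α) b

end VertexOperatorAlgebra

/-- The variable `x` of the field `ℂ((x))((y))`. Rational functions of `x, y` are elements of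
this field through their expansion in the domain `|x| > |y|`. -/
def laurentX : LaurentSeries (LaurentSeries ℂ) := HahnSeries.C (HahnSeries.single 1 1)

/-- The variable `y` of the field `ℂ((x))((y))`. -/
def laurentY : LaurentSeries (LaurentSeries ℂ) := HahnSeries.single 1 1

/-- The explicit homogeneous polynomial of degree 8 in `x, y`, with parameters `p` (the
dimension of `P_2`) and `C` (the central charge), evaluated in a commutative `ℂ`-algebra. -/
def griessPoly {R : Type*} [CommRing R] [Algebra ℂ R] (p C : ℂ) (x y : R) : R :=
  p • (x ^ 4 * y ^ 4)
    + (8 * p / C) • (x ^ 3 * y ^ 3 * (x - y) ^ 2)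
    + (4 * p * (44 - C) / (C * (5 * C + 22))) • (x ^ 2 * y ^ 2 * (x - y) ^ 4)
    + 2 * (x ^ 2 + y ^ 2) * (x - y) ^ 6
    - (x - y) ^ 8

end

/-! Grading and orthogonality of distinct weight spaces give F = ∑ f(n) x^{n-3} y^{-n-1} with f(n) =
∑_α ⟨a, u^α_{2-n} (u_α)_n b⟩. Here f(n) = 0 for n ≥ 4, f(2) = 0 because V_1 = 0, and f(3) = ⟨a, b⟩
because c_3 b = ⟨c, b⟩𝟏 on V_2. Commuting u^α past u_α expresses f(2-m) - f(m) through the Casimir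
vectors λ^{(3)}, λ^{(2)} and p_2; it is a cubic polynomial in m (`coefficient_reflect`). Only f(1)
remains.

The hypothesis on λ^{(4)} supplies the rest. Write λ^{(4)} = x L_{-2}²𝟏 + y L_{-4}𝟏. Applying L_2,
L_2² and L_4 gives λ^{(2)} = (4p_2/C)ω and a linear system for x, y whose determinant is a multiple
of a power of C times 5C+22 (`exists_coordinates`). Skew symmetry then gives λ^{(3)} = ½
L_{-1}λ^{(2)}. Pairing λ^{(4)} with b_{-1}a in two ways, by Virasoro adjoints and by moving u^α_{-1}
across the form, yields f(1) (`coefficient_one`). Since f is cubic far to the left and zero far to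
the right, multiplying by (x-y)^4 leaves finitely many coefficients, which are compared with G
(`eq_smul_griessPoly_div`).

The trace uses only V_2 = ℂω ⊕ P_2 and λ^{(2)}: invariance turns the trace over P_2 into ⟨a • b,
λ^{(2)}⟩.

The axioms contain locality and not the Borcherds identity, so the commutator formula is derived
first: Newton's difference formula expands a local bracket, Dong's lemma keeps its residues local,
and the uniqueness of local fields with given action on the vacuum identifies the residues with the
modes of a_j b. -/

noncomputable section

/-! ### Formal distributions and multiplication by x - y -/

section CrossDifference

variable {E E' : Type*} [AddCommGroup E] [Module ℂ E] [AddCommGroup E'] [Module ℂ E']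

/-- The shift in the first index, i.e. multiplication of `∑ f m n x^{-m-1} y^{-n-1}` by `x`. -/
def shiftFst : Module.End ℂ (ℤ → ℤ → E) where
  toFun f m n := f (m + 1) n
  map_add' _ _ := rfl
  map_smul' _ _ := rfl

/-- The shift in the second index, i.e. multiplication by `y`. -/
def shiftSnd : Module.End ℂ (ℤ → ℤ → E) where
  toFun f m n := f m (n + 1)
  map_add' _ _ := rfl
  map_smul' _ _ := rfl

/-- Multiplication of the formal distribution `∑ f m n x^{-m-1} y^{-n-1}` by `x - y`. -/
def crossDiff : Module.End ℂ (ℤ → ℤ → E) := shiftFst - shiftSnd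

theorem crossDiff_apply (f : ℤ → ℤ → E) (m n : ℤ) :
    crossDiff f m n = f (m + 1) n - f m (n + 1) := rfl

theorem shiftFst_pow_apply (i : ℕ) (f : ℤ → ℤ → E) (m n : ℤ) :
    (shiftFst ^ i) f m n = f (m + i) n := by
  induction i generalizing m with
  | zero => simp
  | succ i ih =>
    rw [pow_succ']
    change (shiftFst ^ i) f (m + 1) n = _
    rw [ih]
    congr 1
    push_cast
    ring

theorem shiftSnd_pow_apply (i : ℕ) (f : ℤ → ℤ → E) (m n : ℤ) :
    (shiftSnd ^ i) f m n = f m (n + i) := by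
  induction i generalizing n with
  | zero => simp
  | succ i ih =>
    rw [pow_succ']
    change (shiftSnd ^ i) f m (n + 1) = _
    rw [ih]
    congr 1
    push_cast
    ring

theorem crossDiff_pow_apply (N : ℕ) (f : ℤ → ℤ → E) (m n : ℤ) :
    (crossDiff ^ N) f m n = ∑ i ∈ Finset.range (N + 1),
      ((-1 : ℂ) ^ i * (N.choose i : ℂ)) • f (m + N - i) (n + i) := by
  have hc : Commute (-shiftSnd : Module.End ℂ (ℤ → ℤ → E)) shiftFst := by
    have h : Commute (shiftSnd : Module.End ℂ (ℤ → ℤ → E)) shiftFst := LinearMap.ext fun f => rfl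
    exact h.neg_left
  have hD : (crossDiff : Module.End ℂ (ℤ → ℤ → E)) = -shiftSnd + shiftFst := by
    rw [crossDiff]; abel
  rw [hD, hc.add_pow, LinearMap.sum_apply, Finset.sum_apply, Finset.sum_apply]
  refine Finset.sum_congr rfl fun i hi => ?_
  have hi' : i ≤ N := by simpa [Nat.lt_succ_iff] using hi
  have h1 : (-shiftSnd : Module.End ℂ (ℤ → ℤ → E)) ^ i = ((-1 : ℂ) ^ i) • shiftSnd ^ i := by
    rw [← neg_one_smul ℂ (shiftSnd : Module.End ℂ (ℤ → ℤ → E)), smul_pow]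
  rw [h1, ← nsmul_eq_mul', ← Nat.cast_smul_eq_nsmul ℂ, smul_mul_assoc, smul_smul, mul_comm]
  simp only [LinearMap.smul_apply, Pi.smul_apply, Module.End.mul_apply]
  rw [shiftSnd_pow_apply, shiftFst_pow_apply, Nat.cast_sub hi']
  congr 2
  ring

theorem crossDiff_pow_comp (φ : E →ₗ[ℂ] E') (N : ℕ) (f : ℤ → ℤ → E) :
    (crossDiff ^ N) (fun m n => φ (f m n)) = fun m n => φ ((crossDiff ^ N) f m n) := by
  funext m n
  simp [crossDiff_pow_apply]

theorem crossDiff_pow_eq_zero_of_le {N M : ℕ} (h : N ≤ M) {f : ℤ → ℤ → E}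
    (hf : (crossDiff ^ N) f = 0) : (crossDiff ^ M) f = 0 := by
  obtain ⟨k, rfl⟩ := Nat.exists_eq_add_of_le' h
  rw [pow_add, Module.End.mul_apply, hf, map_zero]

/-- Multiplication of `∑ f k m n x^{-k-1} y^{-m-1} z^{-n-1}` by `y - z`. -/
def crossDiff₂₃ : Module.End ℂ (ℤ → ℤ → ℤ → E) where
  toFun f k := crossDiff (f k)
  map_add' _ _ := by funext k; simp
  map_smul' _ _ := by funext k; simp

/-- Multiplication of `∑ f k m n x^{-k-1} y^{-m-1} z^{-n-1}` by `x - z`. -/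
def crossDiff₁₃ : Module.End ℂ (ℤ → ℤ → ℤ → E) where
  toFun f k m n := f (k + 1) m n - f k m (n + 1)
  map_add' _ _ := by funext k m n; simp only [Pi.add_apply]; abel
  map_smul' _ _ := by funext k m n; simp [smul_sub]

theorem crossDiff₂₃_pow_apply (N : ℕ) (f : ℤ → ℤ → ℤ → E) (k : ℤ) :
    (crossDiff₂₃ ^ N) f k = (crossDiff ^ N) (f k) := by
  induction N with
  | zero => rfl
  | succ N ih =>
    rw [pow_succ', pow_succ', Module.End.mul_apply, Module.End.mul_apply, ← ih]
    rfl

theorem crossDiff₁₃_pow_apply (N : ℕ) (f : ℤ → ℤ → ℤ → E) (k m n : ℤ) :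
    (crossDiff₁₃ ^ N) f k m n = (crossDiff ^ N) (fun k n => f k m n) k n := by
  induction N generalizing k n with
  | zero => rfl
  | succ N ih =>
    rw [pow_succ', pow_succ', Module.End.mul_apply, Module.End.mul_apply, crossDiff_apply,
      ← ih, ← ih]
    rfl

/-- This is y - z = (x - z) - (x - y), the algebraic core of Dong's lemma; `crossDiff` with values
in `ℤ → E` acts on the first two variables. -/
theorem crossDiff₂₃_eq : (crossDiff₂₃ : Module.End ℂ (ℤ → ℤ → ℤ → E)) =
    crossDiff₁₃ + -crossDiff (E := ℤ → E) := by
  refine LinearMap.ext fun f => ?_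
  funext k m n
  change f k (m + 1) n - f k m (n + 1)
    = f (k + 1) m n - f k m (n + 1) + -(f (k + 1) m n - f k (m + 1) n)
  abel

theorem commute_crossDiff₁₃ : Commute (crossDiff₁₃ : Module.End ℂ (ℤ → ℤ → ℤ → E))
    (crossDiff (E := ℤ → E)) := by
  refine LinearMap.ext fun f => ?_
  funext k m n
  change f (k + 1 + 1) m n - f (k + 1) (m + 1) n - (f (k + 1) m (n + 1) - f k (m + 1) (n + 1))
    = f (k + 1 + 1) m n - f (k + 1) m (n + 1) - (f (k + 1) (m + 1) n - f k (m + 1) (n + 1))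
  abel

theorem commute_crossDiff₂₃ : Commute (crossDiff₂₃ : Module.End ℂ (ℤ → ℤ → ℤ → E))
    (crossDiff (E := ℤ → E)) := by
  rw [crossDiff₂₃_eq]
  have h : Commute (crossDiff (E := ℤ → E)) (crossDiff (E := ℤ → E)) := Commute.refl _
  exact commute_crossDiff₁₃.add_left h.neg_left

theorem commute_crossDiff₁₃_neg : Commute (crossDiff₁₃ : Module.End ℂ (ℤ → ℤ → ℤ → E))
    (-crossDiff (E := ℤ → E)) := by
  have h := commute_crossDiff₁₃ (E := E)
  exact h.neg_right

theorem commute_crossDiff₂₃_neg : Commute (crossDiff₂₃ : Module.End ℂ (ℤ → ℤ → ℤ → E))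
    (-crossDiff (E := ℤ → E)) := by
  have h := commute_crossDiff₂₃ (E := E)
  exact h.neg_right

/-- In each term of the binomial expansion one of the two exponents is at least N. -/
theorem Commute.add_pow_apply_eq_zero {X Y : Module.End ℂ E} (h : Commute X Y) {N : ℕ} {w : E}
    (hX : (X ^ N) w = 0) (hY : (Y ^ N) w = 0) : ((X + Y) ^ (N + N)) w = 0 := by
  have key : ∀ (Z : Module.End ℂ E) (i : ℕ), (Z ^ N) w = 0 → N ≤ i → (Z ^ i) w = 0 := by
    intro Z i hZ hi
    obtain ⟨k, rfl⟩ := Nat.exists_eq_add_of_le' hi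
    rw [pow_add, Module.End.mul_apply, hZ, map_zero]
  rw [h.add_pow, LinearMap.sum_apply]
  refine Finset.sum_eq_zero fun i _ => ?_
  rw [← nsmul_eq_mul', LinearMap.smul_apply]
  rcases le_total N i with hi | hi
  · rw [(h.pow_pow i _).eq, Module.End.mul_apply, key X i hX hi, map_zero, smul_zero]
  · rw [Module.End.mul_apply, key Y _ hY (by omega), map_zero, smul_zero]

/-- Newton's forward difference formula along the lines `m + n = const`. -/
theorem eq_sum_choose_smul_crossDiff (N : ℕ) (f : ℤ → ℤ → E) (hf : (crossDiff ^ N) f = 0)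
    (m n : ℤ) : f m n = ∑ j ∈ Finset.range N,
      Ring.choose (m : ℂ) j • (crossDiff ^ j) f 0 (m + n - j) := by
  induction N generalizing f m n with
  | zero =>
    have : f = 0 := hf
    simp [this]
  | succ N ih =>
    have step : ∀ m n : ℤ, f (m + 1) n - f m (n + 1)
        = ∑ j ∈ Finset.range N, Ring.choose (m : ℂ) j • (crossDiff ^ (j + 1)) f 0 (m + n - j) := by
      intro m n
      have h := ih (crossDiff f) (by rw [← Module.End.mul_apply, ← pow_succ]; exact hf) m n
      rw [crossDiff_apply] at h
      rw [h]
      simp only [pow_succ, Module.End.mul_apply]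
    -- By Pascal's rule the right-hand side obeys the same difference equation as f; at m = 0 only
    -- the j = 0 term survives, and induction in both directions spreads the equality.
    have stepR : ∀ m n : ℤ,
        (∑ j ∈ Finset.range (N + 1),
          Ring.choose ((m + 1 : ℤ) : ℂ) j • (crossDiff ^ j) f 0 (m + 1 + n - j))
        = (∑ j ∈ Finset.range (N + 1),
          Ring.choose (m : ℂ) j • (crossDiff ^ j) f 0 (m + (n + 1) - j))
          + (f (m + 1) n - f m (n + 1)) := by
      intro m n
      rw [step, Finset.sum_range_succ', Finset.sum_range_succ', add_right_comm (Finset.sum _ _),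
        ← Finset.sum_add_distrib]
      congr 1
      · refine Finset.sum_congr rfl fun j _ => ?_
        have e1 : m + 1 + n - ((j + 1 : ℕ) : ℤ) = m + n - j := by push_cast; ring
        have e2 : m + (n + 1) - ((j + 1 : ℕ) : ℤ) = m + n - j := by push_cast; ring
        rw [e1, e2, ← add_smul, Int.cast_add, Int.cast_one, Ring.choose_succ_succ, add_comm]
      · have e : m + 1 + n - ((0 : ℕ) : ℤ) = m + (n + 1) - ((0 : ℕ) : ℤ) := by ring
        rw [Ring.choose_zero_right, Ring.choose_zero_right, e]
    induction m using Int.induction_on generalizing n with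
    | zero =>
      rw [Finset.sum_range_succ', Finset.sum_eq_zero]
      · simp
      · intro j _
        rw [Int.cast_zero, Ring.choose_zero_succ, zero_smul]
    | succ i hi =>
      rw [stepR, ← hi]
      abel
    | pred i hi =>
      have h := stepR (-(i : ℤ) - 1) (n - 1)
      rw [sub_add_cancel, ← hi (n - 1), sub_add_cancel] at h
      rw [← sub_eq_iff_eq_add] at h
      rw [← h]
      abel

end CrossDifference

/-! ### Local sequences of modes and Dong's lemma -/

section Locality

variable {V : Type*} [AddCommGroup V] [Module ℂ V]

/-- The commutators `[a_m, b_n]` of two sequences of modes. -/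
def modeBracket (a b : ℤ → Module.End ℂ V) (m n : ℤ) : Module.End ℂ V := a m * b n - b n * a m

/-- Mutual locality of two sequences of modes. -/
def MutuallyLocal (a b : ℤ → Module.End ℂ V) : Prop :=
  ∃ N : ℕ, (crossDiff ^ N) (modeBracket a b) = 0

/-- The modes of `Res_x (x - y)^j [a(x), b(y)]`. -/
def residueProduct (a b : ℤ → Module.End ℂ V) (j : ℕ) (n : ℤ) : Module.End ℂ V :=
  (crossDiff ^ j) (modeBracket a b) 0 n

theorem MutuallyLocal.sub {a b d : ℤ → Module.End ℂ V} (ha : MutuallyLocal a d)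
    (hb : MutuallyLocal b d) : MutuallyLocal (a - b) d := by
  obtain ⟨N, hN⟩ := ha
  obtain ⟨M, hM⟩ := hb
  refine ⟨max N M, ?_⟩
  have : modeBracket (a - b) d = modeBracket a d - modeBracket b d := by
    funext m n
    simp only [modeBracket, Pi.sub_apply]
    noncomm_ring
  rw [this, map_sub, crossDiff_pow_eq_zero_of_le (le_max_left _ _) hN,
    crossDiff_pow_eq_zero_of_le (le_max_right _ _) hM, sub_zero]

/-- Left multiplication minus right multiplication. -/
def endCommutator (x : Module.End ℂ V) : Module.End ℂ V →ₗ[ℂ] Module.End ℂ V :=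
  LinearMap.mulRight ℂ x - LinearMap.mulLeft ℂ x

theorem endCommutator_apply (x e : Module.End ℂ V) : endCommutator x e = e * x - x * e := rfl

/-- **Dong's lemma** for the residue products of nonnegative order. -/
theorem MutuallyLocal.residueProduct {a b d : ℤ → Module.End ℂ V} (hab : MutuallyLocal a b)
    (had : MutuallyLocal a d) (hbd : MutuallyLocal b d) (j : ℕ) :
    MutuallyLocal (residueProduct a b j) d := by
  obtain ⟨N₁, h₁⟩ := hab
  obtain ⟨N₂, h₂⟩ := had
  obtain ⟨N₃, h₃⟩ := hbd
  set N := max N₁ (max N₂ N₃) with hN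
  replace h₁ := crossDiff_pow_eq_zero_of_le (M := N) (by simp [hN]) h₁
  replace h₂ := crossDiff_pow_eq_zero_of_le (M := N) (by simp [hN]) h₂
  replace h₃ := crossDiff_pow_eq_zero_of_le (M := N) (by simp [hN]) h₃
  let Φ : Module.End ℂ V →ₗ[ℂ] (ℤ → Module.End ℂ V) := LinearMap.pi fun n => endCommutator (d n)
  let W : ℤ → ℤ → ℤ → Module.End ℂ V := fun k m => Φ (modeBracket a b k m)
  let W₁ : ℤ → ℤ → ℤ → Module.End ℂ V := fun k m n =>
    (-endCommutator (a k)) (modeBracket b d m n)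
  let W₂ : ℤ → ℤ → ℤ → Module.End ℂ V := fun k m n => endCommutator (b m) (modeBracket a d k n)
  -- Jacobi identity for [[a(x), b(y)], d(z)].
  have hW : W = W₁ + W₂ := by
    funext k m n
    change (a k * b m - b m * a k) * d n - d n * (a k * b m - b m * a k)
      = -((b m * d n - d n * b m) * a k - a k * (b m * d n - d n * b m))
        + ((a k * d n - d n * a k) * b m - b m * (a k * d n - d n * a k))
    noncomm_ring
  have hW0 : (crossDiff ^ N) W = 0 := by
    rw [crossDiff_pow_comp Φ N (modeBracket a b), h₁]
    funext m n
    exact map_zero Φ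
  have hW₁ : (crossDiff₂₃ ^ N) W₁ = 0 := by
    funext k
    rw [crossDiff₂₃_pow_apply, crossDiff_pow_comp (-endCommutator (a k)) N (modeBracket b d), h₃]
    funext m n
    exact map_zero (-endCommutator (a k))
  have hW₂ : (crossDiff₁₃ ^ N) W₂ = 0 := by
    funext k m n
    rw [crossDiff₁₃_pow_apply, crossDiff_pow_comp (endCommutator (b m)) N (modeBracket a d), h₂]
    exact map_zero (endCommutator (b m))
  have hc : Commute (crossDiff₁₃ : Module.End ℂ (ℤ → ℤ → ℤ → Module.End ℂ V)) crossDiff₂₃ := by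
    rw [crossDiff₂₃_eq]
    exact (Commute.refl _).add_right commute_crossDiff₁₃_neg
  -- The factor (y - z)^N removes W₁, and (x - z)^N then removes W₂.
  have hX : (crossDiff₁₃ ^ N) ((crossDiff₂₃ ^ N) W) = 0 := by
    rw [hW, map_add, hW₁, zero_add, ← Module.End.mul_apply, (hc.pow_pow N N).eq,
      Module.End.mul_apply, hW₂, map_zero]
  have hY : ((-crossDiff (E := ℤ → Module.End ℂ V)) ^ N) ((crossDiff₂₃ ^ N) W) = 0 := by
    rw [← Module.End.mul_apply, ← (commute_crossDiff₂₃_neg.pow_pow N N).eq,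
      Module.End.mul_apply]
    have h : (-crossDiff (E := ℤ → Module.End ℂ V)) ^ N = ((-1 : ℂ) ^ N) • crossDiff ^ N := by
      rw [← neg_one_smul ℂ (crossDiff (E := ℤ → Module.End ℂ V)), smul_pow]
    rw [h, LinearMap.smul_apply, hW0, smul_zero, map_zero]
  -- On (y - z)^N W both x - z and x - y have vanishing N-th powers, so 2N further factors y - z
  -- suffice.
  have h0 : (crossDiff₂₃ ^ (N + N + N)) W = 0 := by
    rw [pow_add, Module.End.mul_apply]
    have h := commute_crossDiff₁₃_neg.add_pow_apply_eq_zero hX hY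
    rwa [← crossDiff₂₃_eq] at h
  refine ⟨N + N + N, ?_⟩
  -- The residue in x is the slice at first index 0.
  have e : modeBracket (_root_.residueProduct a b j) d = (crossDiff ^ j) W 0 := by
    rw [crossDiff_pow_comp Φ j (modeBracket a b)]
    rfl
  rw [e, ← crossDiff₂₃_pow_apply, ← Module.End.mul_apply,
    (commute_crossDiff₂₃.pow_pow (N + N + N) j).eq, Module.End.mul_apply, h0, map_zero]
  rfl

end Locality

/-! ### Uniqueness of fields, translation covariance and the commutator formula -/

namespace VertexOperatorAlgebra

variable {V : Type*} [AddCommGroup V] [Module ℂ V] (A : VertexOperatorAlgebra V)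

theorem mode_add (a b : V) : A.mode (a + b) = A.mode a + A.mode b := by
  unfold mode; rw [map_add, map_add]

theorem mode_smul (c : ℂ) (a : V) : A.mode (c • a) = c • A.mode a := by
  unfold mode; rw [map_smul, map_smul]

theorem mode_zero (n : ℤ) : A.mode 0 n = 0 := by
  unfold mode; rw [map_zero, map_zero]; rfl

theorem mutuallyLocal_mode (a b : V) : MutuallyLocal (A.mode a) (A.mode b) := by
  obtain ⟨N, hN⟩ := A.locality a b
  refine ⟨N, ?_⟩
  funext m n
  refine LinearMap.ext fun v => ?_
  rw [crossDiff_pow_apply, LinearMap.sum_apply]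
  exact hN m n v

/-- A field which is local with all vertex operators and annihilates the vacuum is zero. -/
theorem eq_zero_of_mutuallyLocal {t : ℤ → Module.End ℂ V}
    (ht : ∀ d, MutuallyLocal t (A.mode d)) (hvac : ∀ n, t n A.vac = 0) : t = 0 := by
  funext m
  refine LinearMap.ext fun d => ?_
  obtain ⟨N, hN⟩ := ht d
  -- At these indices the i-th term contains d_{i-1}𝟏, so only i = 0 survives, and it is t_m d.
  have h := LinearMap.congr_fun (congrFun (congrFun hN (m - N)) (-1)) A.vac
  rw [crossDiff_pow_apply, LinearMap.sum_apply, Finset.sum_range_succ', Finset.sum_eq_zero] at h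
  · have hm : A.mode d (-1) A.vac = d := A.mode_vac d
    simpa [modeBracket, hvac, hm] using h
  · intro i _
    have hi : A.mode d (-1 + ((i + 1 : ℕ) : ℤ)) A.vac = 0 :=
      A.mode_vac_of_nonneg d _ (by push_cast; linarith)
    simp only [LinearMap.smul_apply, modeBracket, LinearMap.sub_apply, Module.End.mul_apply, hi,
      hvac, map_zero, sub_zero, smul_zero]

theorem mode_translation (a : V) (n : ℤ) :
    A.mode (A.mode A.conf 0 a) n = (-(n : ℂ)) • A.mode a (n - 1) :=
  LinearMap.ext fun v => A.translation a n v

theorem conf_mode_zero_vac : A.mode A.conf 0 A.vac = 0 := A.mode_vac_of_nonneg _ _ le_rfl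

/-- For n < 0 the translation axiom writes a_{-k-2}𝟏 as (L_{-1}a)_{-k-1}𝟏/(k+1), which reduces
everything to a_{-1}𝟏 = a. -/
theorem conf_mode_zero_mode_vac (a : V) (n : ℤ) :
    A.mode A.conf 0 (A.mode a n A.vac) = A.mode (A.mode A.conf 0 a) n A.vac := by
  rcases le_or_gt 0 n with hn | hn
  · have h : ∀ d, A.mode d n A.vac = 0 := fun d => A.mode_vac_of_nonneg d n hn
    rw [h, h, map_zero]
  · obtain ⟨k, rfl⟩ : ∃ k : ℕ, n = -1 - k := ⟨(-1 - n).toNat, by omega⟩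
    clear hn
    induction k generalizing a with
    | zero =>
      have h : ∀ d, A.mode d (-1) A.vac = d := A.mode_vac
      simp only [Nat.cast_zero, sub_zero, h]
    | succ k ih =>
      have h : ∀ d, A.mode d (-1 - ((k + 1 : ℕ) : ℤ)) A.vac
          = ((k : ℂ) + 1)⁻¹ • A.mode (A.mode A.conf 0 d) (-1 - k) A.vac := by
        intro d
        have hk : (k : ℂ) + 1 ≠ 0 := Nat.cast_add_one_ne_zero k
        rw [mode_translation, LinearMap.smul_apply, smul_smul]
        have e1 : (-1 - (k : ℤ)) - 1 = -1 - ((k + 1 : ℕ) : ℤ) := by push_cast; ring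
        have e2 : ((k : ℂ) + 1)⁻¹ * -((-1 - (k : ℤ) : ℤ) : ℂ) = 1 := by
          push_cast
          field_simp
          ring
        rw [e1, e2, one_smul]
      rw [h, h, map_smul, ih]

/-- `[L_{-1}, a_n] = (L_{-1} a)_n`. -/
theorem conf_mode_zero_commutator (a : V) (n : ℤ) :
    A.mode A.conf 0 * A.mode a n - A.mode a n * A.mode A.conf 0
      = A.mode (A.mode A.conf 0 a) n := by
  have h : residueProduct (A.mode A.conf) (A.mode a) 0 - A.mode (A.mode A.conf 0 a) = 0 := by
    refine A.eq_zero_of_mutuallyLocal (fun d => ?_) (fun n => ?_)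
    · exact ((A.mutuallyLocal_mode _ _).residueProduct (A.mutuallyLocal_mode _ _)
        (A.mutuallyLocal_mode _ _) 0).sub (A.mutuallyLocal_mode _ _)
    · change A.mode A.conf 0 (A.mode a n A.vac) - A.mode a n (A.mode A.conf 0 A.vac)
        - A.mode (A.mode A.conf 0 a) n A.vac = 0
      rw [conf_mode_zero_vac, map_zero, sub_zero, conf_mode_zero_mode_vac, sub_self]
  exact sub_eq_zero.mp (congrFun h n)

/-- `∂_x + ∂_y` on formal distributions. -/
def totalDeriv {E : Type*} [AddCommGroup E] [Module ℂ E] (f : ℤ → ℤ → E) (m n : ℤ) : E :=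
  (-(m : ℂ)) • f (m - 1) n + (-(n : ℂ)) • f m (n - 1)

/-- The operator ∂_x + ∂_y annihilates x - y. -/
theorem crossDiff_pow_totalDeriv {E : Type*} [AddCommGroup E] [Module ℂ E] (j : ℕ)
    (f : ℤ → ℤ → E) : (crossDiff ^ j) (totalDeriv f) = totalDeriv ((crossDiff ^ j) f) := by
  have h1 : ∀ f : ℤ → ℤ → E, crossDiff (totalDeriv f) = totalDeriv (crossDiff f) := by
    intro f
    funext m n
    simp only [crossDiff_apply, totalDeriv, add_sub_cancel_right, sub_add_cancel]
    push_cast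
    module
  induction j with
  | zero => rfl
  | succ j ih => rw [pow_succ', Module.End.mul_apply, Module.End.mul_apply, ih, h1]

/-- Commuting with L_{-1} acts on the bracket as ∂_x + ∂_y; the x-derivative has no residue, and
L_{-1} kills the vacuum. -/
theorem conf_mode_zero_residueProduct (a b : V) (j : ℕ) (n : ℤ) :
    A.mode A.conf 0 (residueProduct (A.mode a) (A.mode b) j n A.vac)
      = (-(n : ℂ)) • residueProduct (A.mode a) (A.mode b) j (n - 1) A.vac := by
  have h : (fun m n => (-endCommutator (A.mode A.conf 0))
      (modeBracket (A.mode a) (A.mode b) m n)) = totalDeriv (modeBracket (A.mode a) (A.mode b)) := by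
    funext m n
    have ha := A.conf_mode_zero_commutator a m
    have hb := A.conf_mode_zero_commutator b n
    rw [mode_translation] at ha hb
    have e : totalDeriv (modeBracket (A.mode a) (A.mode b)) m n
        = (((-(m : ℂ)) • A.mode a (m - 1)) * A.mode b n
            - A.mode b n * ((-(m : ℂ)) • A.mode a (m - 1)))
          + (A.mode a m * ((-(n : ℂ)) • A.mode b (n - 1))
            - ((-(n : ℂ)) • A.mode b (n - 1)) * A.mode a m) := by
      simp only [totalDeriv, modeBracket, smul_sub, smul_mul_assoc, mul_smul_comm]
    rw [e, ← ha, ← hb, LinearMap.neg_apply, endCommutator_apply, modeBracket]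
    noncomm_ring
  have h2 := congrFun (congrFun (crossDiff_pow_totalDeriv j
    (modeBracket (A.mode a) (A.mode b))) 0) n
  rw [← h, crossDiff_pow_comp] at h2
  have h3 := LinearMap.congr_fun h2 A.vac
  simp only [totalDeriv, Int.cast_zero, neg_zero, zero_smul, zero_add, LinearMap.neg_apply,
    endCommutator_apply, LinearMap.sub_apply, Module.End.mul_apply, conf_mode_zero_vac, map_zero,
    zero_sub, neg_neg] at h3
  exact h3

/-- Both sides vanish for n ≥ 0, equal a_j b at n = -1, and obey the same L_{-1}-recursion
downwards. -/
theorem residueProduct_vac (a b : V) (j : ℕ) (n : ℤ) :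
    residueProduct (A.mode a) (A.mode b) j n A.vac = A.mode (A.mode a j b) n A.vac := by
  have hv : ∀ (d : V) (n : ℤ), 0 ≤ n → A.mode d n A.vac = 0 := A.mode_vac_of_nonneg
  have h1 : ∀ d, A.mode d (-1) A.vac = d := A.mode_vac
  rcases le_or_gt 0 n with hn | hn
  · rw [hv _ n hn, residueProduct, crossDiff_pow_apply, LinearMap.sum_apply]
    refine Finset.sum_eq_zero fun i hi => ?_
    have hi' : i ≤ j := by simpa [Nat.lt_succ_iff] using hi
    rw [LinearMap.smul_apply, modeBracket, LinearMap.sub_apply, Module.End.mul_apply,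
      Module.End.mul_apply, hv b _ (by omega), hv a _ (by omega), map_zero, map_zero, sub_zero,
      smul_zero]
  · obtain ⟨k, rfl⟩ : ∃ k : ℕ, n = -1 - k := ⟨(-1 - n).toNat, by omega⟩
    clear hn
    induction k with
    | zero =>
      rw [Nat.cast_zero, sub_zero, h1, residueProduct, crossDiff_pow_apply, LinearMap.sum_apply,
        Finset.sum_range_succ', Finset.sum_eq_zero]
      · simp [modeBracket, h1, hv a j (by omega)]
      · intro i hi
        have hi' : i < j := by simpa using hi
        rw [LinearMap.smul_apply, modeBracket, LinearMap.sub_apply, Module.End.mul_apply,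
          Module.End.mul_apply, hv b _ (by omega), hv a _ (by omega), map_zero, map_zero, sub_zero,
          smul_zero]
    | succ k ih =>
      have e1 : -1 - ((k + 1 : ℕ) : ℤ) = (-1 - (k : ℤ)) - 1 := by push_cast; ring
      have hk : -((-1 - (k : ℤ) : ℤ) : ℂ) ≠ 0 := by
        rw [← Int.cast_neg]
        exact Int.cast_ne_zero.mpr (by omega)
      have hL := A.conf_mode_zero_residueProduct a b j (-1 - k)
      rw [ih, conf_mode_zero_mode_vac, mode_translation, LinearMap.smul_apply] at hL
      rw [e1]
      exact (smul_right_injective V hk hL).symm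

theorem residueProduct_mode (a b : V) (j : ℕ) :
    residueProduct (A.mode a) (A.mode b) j = A.mode (A.mode a j b) := by
  refine sub_eq_zero.mp (A.eq_zero_of_mutuallyLocal (fun d => ?_) (fun n => ?_))
  · exact ((A.mutuallyLocal_mode _ _).residueProduct (A.mutuallyLocal_mode _ _)
      (A.mutuallyLocal_mode _ _) j).sub (A.mutuallyLocal_mode _ _)
  · exact sub_eq_zero.mpr (A.residueProduct_vac a b j n)

/-- **Borcherds' commutator formula.** -/
theorem exists_commutator_formula (a b : V) : ∃ N : ℕ, ∀ M, N ≤ M → ∀ (m n : ℤ) (v : V),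
    A.mode a m (A.mode b n v) - A.mode b n (A.mode a m v)
      = ∑ j ∈ Finset.range M, Ring.choose (m : ℂ) j • A.mode (A.mode a j b) (m + n - j) v := by
  obtain ⟨N, hN⟩ := A.mutuallyLocal_mode a b
  refine ⟨N, fun M hM m n v => ?_⟩
  have h := eq_sum_choose_smul_crossDiff M _ (crossDiff_pow_eq_zero_of_le hM hN) m n
  have h' := LinearMap.congr_fun h v
  rw [LinearMap.sum_apply] at h'
  simp only [LinearMap.smul_apply] at h'
  simp only [← residueProduct_mode]
  exact h'

theorem mode_mem' {k l : ℤ} {a b : V} (ha : a ∈ A.gr k) (hb : b ∈ A.gr l) (n : ℤ) :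
    A.mode a n b ∈ A.gr (k + l - n - 1) := A.mode_mem ha hb n

theorem eq_zero_of_mem_gr_neg {k : ℤ} (hk : k < 0) {a : V} (ha : a ∈ A.gr k) : a = 0 := by
  rw [A.gr_neg k hk] at ha
  exact (Submodule.mem_bot ℂ).mp ha

theorem ringChoose_two (z : ℂ) : Ring.choose z 2 = z * (z - 1) / 2 := by
  rw [Ring.choose_eq_smul, ← Polynomial.aeval_eq_smeval]
  simp [descPochhammer_succ_right, Nat.factorial]
  ring

theorem ringChoose_three (z : ℂ) : Ring.choose z 3 = z * (z - 1) * (z - 2) / 6 := by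
  rw [Ring.choose_eq_smul, ← Polynomial.aeval_eq_smeval]
  simp [descPochhammer_succ_right, Nat.factorial, map_ofNat]
  ring

/-- The commutator formula for two vectors of weight two. -/
theorem commutator_formula_two {a b : V} (ha : a ∈ A.gr 2) (hb : b ∈ A.gr 2) (m n : ℤ) (v : V) :
    A.mode a m (A.mode b n v) - A.mode b n (A.mode a m v)
      = A.mode (A.mode a 0 b) (m + n) v + (m : ℂ) • A.mode (A.mode a 1 b) (m + n - 1) v
        + ((m : ℂ) * (m - 1) / 2) • A.mode (A.mode a 2 b) (m + n - 2) v
        + ((m : ℂ) * (m - 1) * (m - 2) / 6) • A.mode (A.mode a 3 b) (m + n - 3) v := by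
  obtain ⟨N, hN⟩ := A.exists_commutator_formula a b
  -- The cutoff `4 + N` exceeds the locality order and separates j ≤ 3 from the terms where a_j b
  -- has negative weight.
  rw [hN (4 + N) (by omega) m n v, Finset.sum_range_add, Finset.sum_eq_zero (s := Finset.range N),
    add_zero]
  · simp only [Finset.sum_range_succ, Finset.sum_range_zero, zero_add, Ring.choose_zero_right,
      Ring.choose_one_right, ringChoose_two, ringChoose_three, Nat.cast_zero, Nat.cast_one,
      Nat.cast_ofNat, sub_zero, one_smul]
  · intro j _
    rw [A.eq_zero_of_mem_gr_neg (a := A.mode a ((4 + j : ℕ) : ℤ) b) _ (A.mode_mem' ha hb _),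
      mode_zero, LinearMap.zero_apply, smul_zero]
    push_cast
    linarith

end VertexOperatorAlgebra

/-! ### Weight two calculus with V_1 = 0 and an invariant metric -/

namespace VertexOperatorAlgebra

variable {V : Type*} [AddCommGroup V] [Module ℂ V] (A : VertexOperatorAlgebra V)

/-- The mode map `a ↦ a_n`, linear in `a`. -/
def modeHom (n : ℤ) : V →ₗ[ℂ] Module.End ℂ V where
  toFun a := A.mode a n
  map_add' a b := congrFun (A.mode_add a b) n
  map_smul' c a := congrFun (A.mode_smul c a) n

theorem mode_neg (a : V) (n : ℤ) : A.mode (-a) n = -A.mode a n := map_neg (A.modeHom n) a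

theorem mode_sum {ι : Type*} (s : Finset ι) (a : ι → V) (n : ℤ) :
    A.mode (∑ i ∈ s, a i) n = ∑ i ∈ s, A.mode (a i) n := map_sum (A.modeHom n) a s

theorem mode_vac' (a : V) : A.mode a (-1) A.vac = a := A.mode_vac a

theorem mode_vac_eq_zero (a : V) {n : ℤ} (hn : 0 ≤ n) : A.mode a n A.vac = 0 :=
  A.mode_vac_of_nonneg a n hn

theorem vac_mode_apply (n : ℤ) (b : V) : A.mode A.vac n b = if n = -1 then b else 0 :=
  A.vac_mode n b

theorem conf_mode_one {a : V} (ha : a ∈ A.gr 2) : A.mode A.conf 1 a = (2 : ℂ) • a := by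
  have h := A.weight 2 a ha
  exact_mod_cast h

theorem virasoro_mode (m n : ℤ) (v : V) :
    A.mode A.conf m (A.mode A.conf n v) = A.mode A.conf n (A.mode A.conf m v)
      + ((m : ℂ) - n) • A.mode A.conf (m + n - 1) v
      + (if m + n = 2 then ((m : ℂ) - 1) * m * (m - 2) / 12 * A.charge else 0) • v := by
  have h := A.virasoro (m - 1) (n - 1) v
  have e : m - 1 + (n - 1) + 1 = m + n - 1 := by ring
  have e2 : (m - 1 + (n - 1) = 0) = (m + n = 2) := propext (by omega)
  rw [sub_add_cancel, sub_add_cancel, e, sub_eq_iff_eq_add] at h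
  simp only [e2] at h
  refine h.trans ?_
  push_cast
  split_ifs
  · have e3 : ((m : ℂ) - 1) ^ 3 - (m - 1) = (m - 1) * m * (m - 2) := by ring
    rw [e3]
    simp only [mode]
    module
  · simp only [mode]
    module

theorem mode_mem_two {a b : V} (ha : a ∈ A.gr 2) (hb : b ∈ A.gr 2) (n : ℤ) :
    A.mode a n b ∈ A.gr (3 - n) := by
  have h := A.mode_mem' ha hb n
  have e : (2 : ℤ) + 2 - n - 1 = 3 - n := by ring
  rwa [e] at h

theorem mode_one_mem {a b : V} (ha : a ∈ A.gr 2) (hb : b ∈ A.gr 2) : A.mode a 1 b ∈ A.gr 2 :=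
  A.mode_mem_two ha hb 1

theorem mode_eq_zero_of_four_le {a b : V} (ha : a ∈ A.gr 2) (hb : b ∈ A.gr 2) {n : ℤ}
    (hn : 4 ≤ n) : A.mode a n b = 0 :=
  A.eq_zero_of_mem_gr_neg (by omega) (A.mode_mem_two ha hb n)

section Metric

variable {A} {B : LinearMap.BilinForm ℂ V}

theorem eq_zero_of_mem_gr_one (hV1 : A.gr 1 = ⊥) {a : V} (ha : a ∈ A.gr 1) : a = 0 := by
  rw [hV1] at ha
  exact (Submodule.mem_bot ℂ).mp ha

theorem mode_two_eq_zero (hV1 : A.gr 1 = ⊥) {a b : V} (ha : a ∈ A.gr 2) (hb : b ∈ A.gr 2) :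
    A.mode a 2 b = 0 :=
  eq_zero_of_mem_gr_one hV1 (A.mode_mem_two ha hb 2)

/-- Since L_1 c lies in V_1 = 0, only the j = 0 term of the invariance identity remains, with sign
(-1)² = 1. -/
theorem IsLiZMetric.mode_adjoint (hB : A.IsLiZMetric B) (hV1 : A.gr 1 = ⊥) {c : V}
    (hc : c ∈ A.gr 2) (n : ℤ) (a b : V) : B (A.mode c n a) b = B a (A.mode c (2 - n) b) := by
  have hL : A.L 1 c = 0 := mode_two_eq_zero hV1 A.conf_mem hc
  have h := hB.invariant 2 c hc (2 - n) a b
  simp [Finset.sum_range_succ, pow_succ, hL, mode_zero] at h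
  rw [← h]
  congr 3
  ring_nf

theorem IsLiZMetric.mode_three (hB : A.IsLiZMetric B) (hV1 : A.gr 1 = ⊥) {a b : V}
    (ha : a ∈ A.gr 2) (hb : b ∈ A.gr 2) : A.mode a 3 b = B a b • A.vac := by
  have h : A.mode a 3 b ∈ A.gr 0 := A.mode_mem_two ha hb 3
  rw [A.gr_zero] at h
  obtain ⟨c, hc⟩ := Submodule.mem_span_singleton.mp h
  have h1 := hB.mode_adjoint hV1 ha (-1) A.vac b
  rw [mode_vac', show (2 : ℤ) - -1 = 3 by norm_num, ← hc, map_smul, hB.vac_vac, smul_eq_mul,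
    mul_one] at h1
  rw [h1, hc]

theorem IsLiZMetric.commutator (hB : A.IsLiZMetric B) (hV1 : A.gr 1 = ⊥) {a b : V}
    (ha : a ∈ A.gr 2) (hb : b ∈ A.gr 2) (m n : ℤ) (v : V) :
    A.mode a m (A.mode b n v) = A.mode b n (A.mode a m v)
      + A.mode (A.mode a 0 b) (m + n) v + (m : ℂ) • A.mode (A.mode a 1 b) (m + n - 1) v
      + (if m + n = 2 then (m : ℂ) * (m - 1) * (m - 2) / 6 * B a b else 0) • v := by
  have h := A.commutator_formula_two ha hb m n v
  rw [mode_two_eq_zero hV1 ha hb, hB.mode_three hV1 ha hb, mode_zero, LinearMap.zero_apply,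
    smul_zero, add_zero, mode_smul, Pi.smul_apply, LinearMap.smul_apply, vac_mode_apply,
    sub_eq_iff_eq_add] at h
  have e : (m + n - 3 = -1) = (m + n = 2) := propext (by omega)
  simp only [e] at h
  rw [h]
  split_ifs <;> module

/-- Apply [a_{-1}, b_1] to the vacuum. -/
theorem IsLiZMetric.mode_one_comm (hB : A.IsLiZMetric B) (hV1 : A.gr 1 = ⊥) {a b : V}
    (ha : a ∈ A.gr 2) (hb : b ∈ A.gr 2) : A.mode a 1 b = A.mode b 1 a := by
  have h := hB.commutator hV1 ha hb (-1) 1 A.vac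
  norm_num [mode_vac', mode_vac_eq_zero] at h
  exact (add_neg_eq_zero.mp h.symm).symm

/-- Skew symmetry of the zeroth products. -/
theorem IsLiZMetric.mode_zero_skew (hB : A.IsLiZMetric B) (hV1 : A.gr 1 = ⊥) {a b : V}
    (ha : a ∈ A.gr 2) (hb : b ∈ A.gr 2) :
    A.mode b 0 a = -A.mode a 0 b + A.mode A.conf 0 (A.mode a 1 b) := by
  have h := hB.commutator hV1 ha hb (-1) 0 A.vac
  have ht := LinearMap.congr_fun (A.mode_translation (A.mode a 1 b) (-1)) A.vac
  norm_num [mode_vac', mode_vac_eq_zero] at h ht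
  rw [ht]
  have h' := sub_eq_zero.mpr h
  rw [← sub_eq_zero, ← neg_eq_zero, ← h']
  abel

theorem IsLiZMetric.apply_conf_conf (hB : A.IsLiZMetric B) (hV1 : A.gr 1 = ⊥) :
    B A.conf A.conf = A.charge / 2 := by
  have h := A.virasoro_mode 3 (-1) A.vac
  rw [mode_vac', hB.mode_three hV1 A.conf_mem A.conf_mem] at h
  have h' := congrArg (B A.vac) h
  norm_num [mode_vac_eq_zero, hB.vac_vac] at h'
  rw [h']
  ring

/-- On V_2, L_1 lands in V_1 = 0, L_n lands in negative weight for n ≥ 3, and L_2 a = ⟨ω, a⟩𝟏 is the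
only condition left. -/
theorem IsLiZMetric.mem_primary_iff (hB : A.IsLiZMetric B) (hV1 : A.gr 1 = ⊥) {a : V} :
    a ∈ A.primary 2 ↔ a ∈ A.gr 2 ∧ B A.conf a = 0 := by
  simp only [primary, Submodule.mem_inf, Submodule.mem_iInf, LinearMap.mem_ker]
  refine and_congr_right fun ha => ⟨fun h => ?_, fun h n hn => ?_⟩
  · have h2 : A.mode A.conf 3 a = 0 := h 2 (by norm_num)
    rw [hB.mode_three hV1 A.conf_mem ha] at h2
    exact (smul_eq_zero.mp h2).resolve_right A.vac_ne_zero
  · change A.mode A.conf (n + 1) a = 0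
    obtain rfl | rfl | hn3 : n = 1 ∨ n = 2 ∨ 3 ≤ n := by omega
    · exact mode_two_eq_zero hV1 A.conf_mem ha
    · have := hB.mode_three hV1 A.conf_mem ha
      rwa [h, zero_smul] at this
    · exact A.mode_eq_zero_of_four_le A.conf_mem ha (by omega)

/-- The modes of primary vectors of weight two under the Virasoro algebra. -/
theorem IsLiZMetric.conf_mode_commutator (hB : A.IsLiZMetric B) (hV1 : A.gr 1 = ⊥) {a : V}
    (ha : a ∈ A.primary 2) (m n : ℤ) (v : V) :
    A.mode A.conf m (A.mode a n v) = A.mode a n (A.mode A.conf m v)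
      + ((m : ℂ) - n) • A.mode a (m + n - 1) v := by
  obtain ⟨ha2, ha0⟩ := (hB.mem_primary_iff hV1).mp ha
  rw [hB.commutator hV1 A.conf_mem ha2, mode_translation, conf_mode_one _ ha2, mode_smul, ha0]
  simp only [LinearMap.smul_apply, Pi.smul_apply, mul_zero, ite_self, zero_smul]
  push_cast
  module

theorem conf_mode_eq_zero (hV1 : A.gr 1 = ⊥) (hB : A.IsLiZMetric B) {a : V}
    (ha : a ∈ A.primary 2) {n : ℤ} (hn : 2 ≤ n) : A.mode A.conf n a = 0 := by
  obtain ⟨ha2, ha0⟩ := (hB.mem_primary_iff hV1).mp ha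
  obtain rfl | rfl | h : n = 2 ∨ n = 3 ∨ 4 ≤ n := by omega
  · exact mode_two_eq_zero hV1 A.conf_mem ha2
  · rw [hB.mode_three hV1 A.conf_mem ha2, ha0, zero_smul]
  · exact A.mode_eq_zero_of_four_le A.conf_mem ha2 h

end Metric

/-! ### Virasoro descendants of the vacuum up to weight four -/

section Descendants

theorem conf_mode_zero_conf : A.mode A.conf 0 A.conf = A.mode A.conf (-2) A.vac := by
  have ht := LinearMap.congr_fun (A.mode_translation A.conf (-1)) A.vac
  norm_num [mode_vac'] at ht
  exact ht

/-- The descendant `L_{-i₁} ⋯ L_{-iₛ} 𝟏`. -/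
def descendant (l : List ℕ) : V := l.foldr (fun i w => A.L (-(i : ℤ)) w) A.vac

theorem descendant_cons (i : ℕ) (l : List ℕ) :
    A.descendant (i :: l) = A.mode A.conf (1 - i) (A.descendant l) := by
  have e : (1 : ℤ) - i = -(i : ℤ) + 1 := by ring
  rw [e]
  rfl

theorem exists_eq_cons {l : List ℕ} (hl : ∀ i ∈ l, 1 ≤ i) {n : ℕ} (hs : l.sum = n + 1) :
    ∃ (i : ℕ) (t : List ℕ), l = i :: t ∧ 1 ≤ i ∧ i + t.sum = n + 1 ∧ ∀ i ∈ t, 1 ≤ i := by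
  cases l with
  | nil => simp at hs
  | cons i t => exact ⟨i, t, rfl, hl i (by simp), by simpa using hs,
      fun j hj => hl j (List.mem_cons_of_mem i hj)⟩

theorem descendant_zero {l : List ℕ} (hl : ∀ i ∈ l, 1 ≤ i) (hs : l.sum = 0) :
    A.descendant l = A.vac := by
  cases l with
  | nil => rfl
  | cons i t =>
    have := hl i (by simp)
    simp at hs
    omega

theorem descendant_one {l : List ℕ} (hl : ∀ i ∈ l, 1 ≤ i) (hs : l.sum = 1) :
    A.descendant l = 0 := by
  obtain ⟨i, t, rfl, hi, hs, ht⟩ := exists_eq_cons hl hs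
  obtain rfl : i = 1 := by omega
  rw [descendant_cons, A.descendant_zero ht (by omega)]
  exact A.conf_mode_zero_vac

theorem exists_descendant_two {l : List ℕ} (hl : ∀ i ∈ l, 1 ≤ i) (hs : l.sum = 2) :
    ∃ c : ℂ, A.descendant l = c • A.conf := by
  obtain ⟨i, t, rfl, hi, hs, ht⟩ := exists_eq_cons hl hs
  obtain rfl | rfl : i = 1 ∨ i = 2 := by omega
  · exact ⟨0, by rw [descendant_cons, A.descendant_one ht (by omega), map_zero, zero_smul]⟩
  · refine ⟨1, ?_⟩
    rw [descendant_cons, A.descendant_zero ht (by omega), one_smul]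
    exact A.mode_vac' _

theorem exists_descendant_three {l : List ℕ} (hl : ∀ i ∈ l, 1 ≤ i) (hs : l.sum = 3) :
    ∃ c : ℂ, A.descendant l = c • A.mode A.conf (-2) A.vac := by
  obtain ⟨i, t, rfl, hi, hs, ht⟩ := exists_eq_cons hl hs
  obtain rfl | rfl | rfl : i = 1 ∨ i = 2 ∨ i = 3 := by omega
  · obtain ⟨c, hc⟩ := A.exists_descendant_two ht (by omega)
    exact ⟨c, by rw [descendant_cons, hc, map_smul, ← conf_mode_zero_conf]; rfl⟩
  · exact ⟨0, by rw [descendant_cons, A.descendant_one ht (by omega), map_zero, zero_smul]⟩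
  · exact ⟨1, by rw [descendant_cons, A.descendant_zero ht (by omega), one_smul]; rfl⟩

/-- Since L_{-1}𝟏 = 0 and L_{-1}L_{-3}𝟏 = 2L_{-4}𝟏, only L_{-2}²𝟏 and L_{-4}𝟏 are needed. -/
theorem exists_descendant_four {l : List ℕ} (hl : ∀ i ∈ l, 1 ≤ i) (hs : l.sum = 4) :
    ∃ x y : ℂ, A.descendant l
      = x • A.mode A.conf (-1) A.conf + y • A.mode A.conf (-3) A.vac := by
  obtain ⟨i, t, rfl, hi, hs, ht⟩ := exists_eq_cons hl hs
  obtain rfl | rfl | rfl | rfl : i = 1 ∨ i = 2 ∨ i = 3 ∨ i = 4 := by omega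
  · obtain ⟨c, hc⟩ := A.exists_descendant_three ht (by omega)
    refine ⟨0, c * 2, ?_⟩
    have h0 : A.mode A.conf 0 (A.mode A.conf (-2) A.vac)
        = (2 : ℂ) • A.mode A.conf (-3) A.vac := by
      have h := LinearMap.congr_fun (A.mode_translation A.conf (-2)) A.vac
      norm_num at h
      rw [conf_mode_zero_mode_vac, h]
    rw [descendant_cons, hc, map_smul, zero_smul, zero_add, mul_smul, ← h0]
    rfl
  · obtain ⟨c, hc⟩ := A.exists_descendant_two ht (by omega)
    refine ⟨c, 0, ?_⟩
    rw [descendant_cons, hc, map_smul, zero_smul, add_zero]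
    rfl
  · exact ⟨0, 0, by
      rw [descendant_cons, A.descendant_one ht (by omega), map_zero, zero_smul, zero_smul, add_zero]⟩
  · refine ⟨0, 1, ?_⟩
    rw [descendant_cons, A.descendant_zero ht (by omega), zero_smul, one_smul, zero_add]
    rfl

theorem exists_of_mem_vacDescendants_four {v : V} (hv : v ∈ A.vacDescendants 4) :
    ∃ x y : ℂ, v = x • A.mode A.conf (-1) A.conf + y • A.mode A.conf (-3) A.vac := by
  have hle : A.vacDescendants 4
      ≤ Submodule.span ℂ {A.mode A.conf (-1) A.conf, A.mode A.conf (-3) A.vac} := by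
    refine Submodule.span_le.mpr ?_
    rintro _ ⟨l, hl, hs, rfl⟩
    obtain ⟨x, y, h⟩ := A.exists_descendant_four hl hs
    exact Submodule.mem_span_pair.mpr ⟨x, y, h.symm⟩
  obtain ⟨x, y, h⟩ := Submodule.mem_span_pair.mp (hle hv)
  exact ⟨x, y, h.symm⟩

end Descendants

end VertexOperatorAlgebra

/-! ### Casimir vectors and the coefficients of the correlation function -/

namespace VertexOperatorAlgebra

variable {V : Type*} [AddCommGroup V] [Module ℂ V] {A : VertexOperatorAlgebra V}
  {B : LinearMap.BilinForm ℂ V}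

section DualBases

variable {ι : Type*} [Fintype ι] [DecidableEq ι] {u u' : Module.Basis ι ℂ (A.primary 2)}

theorem sum_dual_smul (hdual : ∀ α β : ι, B (u' α) (u β) = if α = β then 1 else 0)
    {p : V} (hp : p ∈ A.primary 2) : ∑ α, B (u' α) p • (u α : V) = p := by
  have h := congrArg (Subtype.val) (u.sum_repr ⟨p, hp⟩)
  simp only [AddSubmonoidClass.coe_finsetSum, SetLike.val_smul] at h
  have h2 : ∀ α, B (u' α) p = u.repr ⟨p, hp⟩ α := by
    intro α
    conv_lhs => rw [← h]
    simp [map_sum, hdual]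
  simp only [h2, h]

theorem sum_dual_smul' (hB : A.IsLiZMetric B)
    (hdual : ∀ α β : ι, B (u' α) (u β) = if α = β then 1 else 0)
    {p : V} (hp : p ∈ A.primary 2) : ∑ α, B (u α) p • (u' α : V) = p := by
  refine sum_dual_smul (fun α β => ?_) hp
  rw [hB.symm, hdual]
  simp only [eq_comm]

/-- The Casimir tensor of the space of primary vectors is symmetric. -/
theorem sum_casimir_symm {W : Type*} [AddCommGroup W] [Module ℂ W] (hB : A.IsLiZMetric B)
    (hdual : ∀ α β : ι, B (u' α) (u β) = if α = β then 1 else 0) (φ : V →ₗ[ℂ] V →ₗ[ℂ] W) :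
    ∑ α, φ (u' α) (u α) = ∑ α, φ (u α) (u' α) := by
  have h1 : ∀ α, φ (u' α) (u α) = ∑ β, B (u' β) (u' α) • φ (u β) (u α) := by
    intro α
    conv_lhs => rw [← sum_dual_smul hdual (u' α).2]
    simp only [map_sum, map_smul, LinearMap.sum_apply, LinearMap.smul_apply]
  have h2 : ∀ β, φ (u β) (u' β) = ∑ α, B (u' β) (u' α) • φ (u β) (u α) := by
    intro β
    conv_lhs => rw [← sum_dual_smul hdual (u' β).2]
    simp only [map_sum, map_smul]
    exact Finset.sum_congr rfl fun α _ => by rw [hB.symm]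
  simp only [h1, h2]
  exact Finset.sum_comm

theorem sum_dual_apply (hdual : ∀ α β : ι, B (u' α) (u β) = if α = β then 1 else 0) :
    ∑ α, B (u' α) (u α) = (Module.finrank ℂ (A.primary 2) : ℂ) := by
  simp [hdual, Module.finrank_eq_card_basis u]

end DualBases

/-- The hypotheses of the genus zero computation: dual bases of the primary vectors of weight two
of a vertex operator algebra with `V_1 = 0` whose Casimir vector of weight four is a Virasoro
descendant. -/
structure CasimirData (A : VertexOperatorAlgebra V) (B : LinearMap.BilinForm ℂ V) {ι : Type*}
    [Fintype ι] [DecidableEq ι] (u u' : Module.Basis ι ℂ (A.primary 2)) : Prop where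
  metric : A.IsLiZMetric B
  gr_one : A.gr 1 = ⊥
  dual : ∀ α β : ι, B (u' α) (u β) = if α = β then 1 else 0
  charge_ne_zero : A.charge ≠ 0
  charge_ne : A.charge ≠ -22 / 5
  casimir_mem : A.casimir (fun α => (u α : V)) (fun α => (u' α : V)) 4 ∈ A.vacDescendants 4

namespace CasimirData

variable {ι : Type*} [Fintype ι] [DecidableEq ι] {u u' : Module.Basis ι ℂ (A.primary 2)}

local notation "p₂" => (Module.finrank ℂ (A.primary 2) : ℂ)

theorem mem_two (h : CasimirData A B u u') (p : A.primary 2) : (p : V) ∈ A.gr 2 :=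
  ((h.metric.mem_primary_iff h.gr_one).mp p.2).1

/-- Positive Virasoro modes kill u_α and only shift the mode of u^α, so they carry Casimir vectors
to multiples of lower ones. -/
theorem conf_mode_sum (h : CasimirData A B u u') {m : ℤ} (hm : 2 ≤ m) (n : ℤ) :
    A.mode A.conf m (∑ α, A.mode (u' α : V) n (u α))
      = ((m : ℂ) - n) • ∑ α, A.mode (u' α : V) (m + n - 1) (u α) := by
  rw [map_sum, Finset.smul_sum]
  refine Finset.sum_congr rfl fun α _ => ?_
  rw [h.metric.conf_mode_commutator h.gr_one (u' α).2,
    conf_mode_eq_zero h.gr_one h.metric (u α).2 hm, map_zero, zero_add]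

theorem sum_mode_three (h : CasimirData A B u u') :
    ∑ α, A.mode (u' α : V) 3 (u α) = p₂ • A.vac := by
  simp only [h.metric.mode_three h.gr_one (h.mem_two _) (h.mem_two _), ← Finset.sum_smul,
    sum_dual_apply h.dual]

theorem conf_mode_three_conf (h : CasimirData A B u u') :
    A.mode A.conf 3 A.conf = (A.charge / 2) • A.vac := by
  rw [h.metric.mode_three h.gr_one A.conf_mem A.conf_mem, h.metric.apply_conf_conf h.gr_one]

theorem smul_vac_injective {c d : ℂ} (h : c • A.vac = d • A.vac) : c = d :=
  smul_left_injective ℂ A.vac_ne_zero h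

/-- The coordinates of `λ^{(4)}` in the Virasoro descendants, and the value of `λ^{(2)}`. -/
theorem exists_coordinates (h : CasimirData A B u u') : ∃ x y : ℂ,
    ∑ α, A.mode (u' α : V) (-1) (u α)
      = x • A.mode A.conf (-1) A.conf + y • A.mode A.conf (-3) A.vac
    ∧ (∑ α, A.mode (u' α : V) 1 (u α)) = (4 * p₂ / A.charge) • A.conf
    ∧ ((8 + A.charge) * x + 6 * y) * A.charge = 16 * p₂
    ∧ 3 * A.charge * x + 5 * A.charge * y = 6 * p₂ := by
  obtain ⟨x, y, hxy⟩ := A.exists_of_mem_vacDescendants_four h.casimir_mem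
  replace hxy : ∑ α, A.mode (u' α : V) (-1) (u α)
      = x • A.mode A.conf (-1) A.conf + y • A.mode A.conf (-3) A.vac := hxy
  have h31 : A.mode A.conf 3 (A.mode A.conf (-1) A.conf) = (8 + A.charge) • A.conf := by
    rw [virasoro_mode, h.conf_mode_three_conf, map_smul, mode_vac']
    norm_num [conf_mode_one _ A.conf_mem]
    module
  have h33 : A.mode A.conf 3 (A.mode A.conf (-3) A.vac) = (6 : ℂ) • A.conf := by
    rw [virasoro_mode, mode_vac_eq_zero _ _ (by norm_num), map_zero]
    norm_num [mode_vac']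
  have h51 : A.mode A.conf 5 (A.mode A.conf (-1) A.conf) = (3 * A.charge) • A.vac := by
    rw [virasoro_mode, A.mode_eq_zero_of_four_le A.conf_mem A.conf_mem (by norm_num), map_zero]
    norm_num [h.conf_mode_three_conf]
    module
  have h53 : A.mode A.conf 5 (A.mode A.conf (-3) A.vac) = (5 * A.charge) • A.vac := by
    rw [virasoro_mode, mode_vac_eq_zero _ _ (by norm_num), map_zero]
    norm_num [mode_vac_eq_zero]
  -- L_2 λ^{(4)} = 4λ^{(2)}; a second L_2 gives `e2`, while L_4 λ^{(4)} = 6p_2 𝟏 gives `e3`.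
  have e1 : (4 : ℂ) • ∑ α, A.mode (u' α : V) 1 (u α) = ((8 + A.charge) * x + 6 * y) • A.conf := by
    have e := h.conf_mode_sum (m := 3) (by norm_num) (-1)
    rw [hxy, map_add, map_smul, map_smul, h31, h33] at e
    norm_num at e
    rw [← e]
    module
  have e2 : ((8 + A.charge) * x + 6 * y) * A.charge = 16 * p₂ := by
    have e := congrArg (A.mode A.conf 3) e1
    rw [map_smul, map_smul, h.conf_mode_sum (by norm_num), h.conf_mode_three_conf] at e
    norm_num [h.sum_mode_three, smul_smul] at e
    have e' := smul_vac_injective e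
    linear_combination -2 * e'
  have e3 : 3 * A.charge * x + 5 * A.charge * y = 6 * p₂ := by
    have e := h.conf_mode_sum (m := 5) (by norm_num) (-1)
    rw [hxy, map_add, map_smul, map_smul, h51, h53] at e
    norm_num [h.sum_mode_three, smul_smul, ← add_smul] at e
    have e' := smul_vac_injective e
    linear_combination e'
  refine ⟨x, y, hxy, ?_, e2, e3⟩
  have h4 : (4 : ℂ) ≠ 0 := by norm_num
  refine smul_right_injective V h4 ?_
  change (4 : ℂ) • _ = (4 : ℂ) • _
  rw [e1, smul_smul]
  congr 1
  have := h.charge_ne_zero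
  field_simp
  linear_combination e2

theorem sum_mode_one (h : CasimirData A B u u') :
    (∑ α, A.mode (u' α : V) 1 (u α)) = (4 * p₂ / A.charge) • A.conf := by
  obtain ⟨_, _, _, h1, _⟩ := h.exists_coordinates
  exact h1

theorem sum_mode_symm (h : CasimirData A B u u') (n : ℤ) :
    (∑ α, A.mode (u α : V) n (u' α)) = ∑ α, A.mode (u' α : V) n (u α) :=
  (sum_casimir_symm h.metric h.dual (A.modeHom n)).symm

/-- Symmetry of the Casimir tensor and skew symmetry give λ^{(3)} = -λ^{(3)} + L_{-1}λ^{(2)}. -/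
theorem sum_mode_zero (h : CasimirData A B u u') :
    (∑ α, A.mode (u' α : V) 0 (u α)) = (2 * p₂ / A.charge) • A.mode A.conf 0 A.conf := by
  have e : (∑ α, A.mode (u' α : V) 0 (u α)) = -(∑ α, A.mode (u' α : V) 0 (u α))
      + A.mode A.conf 0 (∑ α, A.mode (u' α : V) 1 (u α)) := by
    rw [← h.sum_mode_symm 0, ← h.sum_mode_symm 1, map_sum, ← Finset.sum_neg_distrib,
      ← Finset.sum_add_distrib, h.sum_mode_symm]
    exact Finset.sum_congr rfl fun α _ =>
      h.metric.mode_zero_skew h.gr_one (h.mem_two _) (h.mem_two _)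
  rw [h.sum_mode_one, map_smul] at e
  have h2 : (2 : ℂ) ≠ 0 := by norm_num
  refine smul_right_injective V h2 ?_
  change (2 : ℂ) • _ = (2 : ℂ) • _
  rw [two_smul]
  nth_rewrite 1 [e]
  module

/-- The correlation coefficient `∑_α ⟨a, u^α_{2-n} (u_α)_n b⟩`. -/
def coefficient (B : LinearMap.BilinForm ℂ V) (u u' : Module.Basis ι ℂ (A.primary 2)) (a b : V)
    (n : ℤ) : ℂ :=
  ∑ α, B a (A.mode (u' α : V) (2 - n) (A.mode (u α : V) n b))

theorem sum_symm (h : CasimirData A B u u') (a b : V) (m n : ℤ) :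
    ∑ α, B a (A.mode (u α : V) m (A.mode (u' α : V) n b))
      = ∑ α, B a (A.mode (u' α : V) m (A.mode (u α : V) n b)) := by
  let φ : V →ₗ[ℂ] V →ₗ[ℂ] ℂ := LinearMap.mk₂ ℂ (fun x y => B a (A.mode x m (A.mode y n b)))
    (fun x y z => by simp [mode_add]) (fun c x y => by simp [mode_smul])
    (fun x y z => by simp [mode_add]) (fun c x y => by simp [mode_smul])
  exact (sum_casimir_symm h.metric h.dual φ).symm

variable {a b : V}

theorem coefficient_of_four_le (h : CasimirData A B u u') (hb : b ∈ A.primary 2) {n : ℤ}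
    (hn : 4 ≤ n) : coefficient B u u' a b n = 0 := by
  refine Finset.sum_eq_zero fun α _ => ?_
  rw [A.mode_eq_zero_of_four_le (h.mem_two _) (h.mem_two ⟨b, hb⟩) hn, map_zero, map_zero]

theorem coefficient_two (h : CasimirData A B u u') (hb : b ∈ A.primary 2) :
    coefficient B u u' a b 2 = 0 := by
  refine Finset.sum_eq_zero fun α _ => ?_
  rw [mode_two_eq_zero h.gr_one (h.mem_two _) (h.mem_two ⟨b, hb⟩), map_zero, map_zero]

theorem coefficient_three (h : CasimirData A B u u') (hb : b ∈ A.primary 2) :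
    coefficient B u u' a b 3 = B a b := by
  have e := congrArg (B a) (sum_dual_smul' h.metric h.dual hb)
  rw [map_sum] at e
  rw [← e]
  refine Finset.sum_congr rfl fun α _ => ?_
  rw [h.metric.mode_three h.gr_one (h.mem_two _) (h.mem_two ⟨b, hb⟩), map_smul]
  norm_num [mode_vac']

/-- Sum the commutators [u^α_m, (u_α)_{2-m}] over α. The shift m - 1 combines λ^{(3)}_2 b =
-(8p_2/C)b with mλ^{(2)}_1 b = (8p_2 m/C)b; the cubic is the central term. -/
theorem coefficient_reflect (h : CasimirData A B u u') (hb : b ∈ A.primary 2) (m : ℤ) :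
    coefficient B u u' a b (2 - m) = coefficient B u u' a b m
      + B a b * (8 * p₂ / A.charge * (m - 1) + p₂ * (m * (m - 1) * (m - 2) / 6)) := by
  have hb2 : b ∈ A.gr 2 := h.mem_two ⟨b, hb⟩
  have e : coefficient B u u' a b (2 - m)
      = ∑ α, B a (A.mode (u α : V) (2 - m) (A.mode (u' α : V) m b))
        + B a (A.mode (∑ α, A.mode (u' α : V) 0 (u α)) 2 b)
        + m * B a (A.mode (∑ α, A.mode (u' α : V) 1 (u α)) 1 b)
        + m * (m - 1) * (m - 2) / 6 * (∑ α, B (u' α : V) (u α)) * B a b := by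
    simp only [coefficient, mode_sum, LinearMap.sum_apply, map_sum, Finset.mul_sum, Finset.sum_mul,
      ← Finset.sum_add_distrib]
    refine Finset.sum_congr rfl fun α _ => ?_
    have e1 : m + (2 - m) = 2 := by ring
    rw [sub_sub_cancel, h.metric.commutator h.gr_one (h.mem_two _) (h.mem_two _), e1]
    simp
  rw [e, h.sum_symm, h.sum_mode_zero, h.sum_mode_one, sum_dual_apply h.dual, mode_smul, mode_smul,
    Pi.smul_apply, Pi.smul_apply, mode_translation]
  have hw := conf_mode_one A hb2
  norm_num [hw, coefficient]
  ring

theorem mode_one_conf (h : CasimirData A B u u') (hb : b ∈ A.gr 2) :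
    A.mode b 1 A.conf = (2 : ℂ) • b := by
  rw [h.metric.mode_one_comm h.gr_one hb A.conf_mem, conf_mode_one _ hb]

theorem apply_mode_one_conf (h : CasimirData A B u u') (hb : b ∈ A.gr 2) :
    B (A.mode b 1 a) A.conf = 2 * B a b := by
  rw [h.metric.mode_adjoint h.gr_one hb, show (2 : ℤ) - 1 = 1 by norm_num, h.mode_one_conf hb,
    map_smul, smul_eq_mul]

theorem conf_mode_mode (h : CasimirData A B u u') (ha : a ∈ A.primary 2) (hb : b ∈ A.primary 2)
    {m : ℤ} (hm : 2 ≤ m) (n : ℤ) :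
    A.mode A.conf m (A.mode b n a) = ((m : ℂ) - n) • A.mode b (m + n - 1) a := by
  rw [h.metric.conf_mode_commutator h.gr_one hb, conf_mode_eq_zero h.gr_one h.metric ha hm,
    map_zero, zero_add]

/-- Commuting c_3 past b_{-1} produces 3(c_1 b)_1 a; rewriting c_0 b by skew symmetry contributes
-2(c_1 b)_1 a, leaving one copy. Then [b_0, c_2]a and c_2 a = 0 convert (b_0 c)_2 a into -c_2 b_0 a.
-/
theorem mode_three_mode_neg_one (h : CasimirData A B u u') {c : V} (ha : a ∈ A.gr 2)
    (hb : b ∈ A.gr 2) (hc : c ∈ A.gr 2) :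
    A.mode c 3 (A.mode b (-1) a) = B c a • b + A.mode c 2 (A.mode b 0 a)
      + A.mode a 1 (A.mode c 1 b) + B c b • a := by
  have e1 := h.metric.commutator h.gr_one hc hb 3 (-1) a
  have e2 := h.metric.mode_zero_skew h.gr_one hb hc
  have e3 := h.metric.commutator h.gr_one hb hc 0 2 a
  have e4 := h.metric.mode_one_comm h.gr_one hb hc
  have e5 := h.metric.mode_one_comm h.gr_one (A.mode_one_mem hc hb) ha
  rw [mode_two_eq_zero h.gr_one hc ha, map_zero] at e3
  rw [e1, e2, mode_add, Pi.add_apply, mode_neg, h.metric.mode_three h.gr_one hc ha, map_smul,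
    mode_vac', e4, mode_translation]
  norm_num [e4, e5] at e3 ⊢
  have e6 : A.mode (A.mode b 0 c) 2 a = -A.mode c 2 (A.mode b 0 a) :=
    (neg_eq_of_add_eq_zero_right e3.symm).symm
  rw [e6]
  module

theorem coefficient_one (h : CasimirData A B u u') (ha : a ∈ A.primary 2) (hb : b ∈ A.primary 2) :
    coefficient B u u' a b 1
      = (4 * p₂ * (44 - A.charge) / (A.charge * (5 * A.charge + 22)) - 2) * B a b := by
  have ha2 : a ∈ A.gr 2 := h.mem_two ⟨a, ha⟩
  have hb2 : b ∈ A.gr 2 := h.mem_two ⟨b, hb⟩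
  obtain ⟨x, y, hxy, h1, h2, h3⟩ := h.exists_coordinates
  -- First evaluation of ⟨b_{-1}a, λ^{(4)}⟩: the adjoints L_2 and L_4 act on b_{-1}a.
  have hl : B (A.mode b (-1) a) (∑ α, A.mode (u' α : V) (-1) (u α))
      = (8 * x + 6 * y) * B a b := by
    have t1 : B (A.mode b (-1) a) (A.mode A.conf (-1) A.conf) = 8 * B a b := by
      have := h.metric.mode_adjoint h.gr_one A.conf_mem 3 (A.mode b (-1) a) A.conf
      norm_num at this
      rw [← this, h.conf_mode_mode ha hb (by norm_num)]
      norm_num [h.apply_mode_one_conf hb2]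
      ring
    have t2 : B (A.mode b (-1) a) (A.mode A.conf (-3) A.vac) = 6 * B a b := by
      have := h.metric.mode_adjoint h.gr_one A.conf_mem 5 (A.mode b (-1) a) A.vac
      norm_num at this
      rw [← this, h.conf_mode_mode ha hb (by norm_num)]
      norm_num [h.metric.mode_three h.gr_one hb2 ha2, h.metric.vac_vac]
      exact h.metric.symm _ _
    rw [hxy, map_add, map_smul, map_smul, t1, t2, smul_eq_mul, smul_eq_mul]
    ring
  -- Second evaluation: the adjoint u^α_3 acts on b_{-1}a, which produces f(1) with a and b
  -- exchanged.
  have hr : B (A.mode b (-1) a) (∑ α, A.mode (u' α : V) (-1) (u α))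
      = B b (∑ α, B (u' α) a • (u α : V))
        + B (A.mode b 0 a) (∑ α, A.mode (u' α : V) 0 (u α))
        + ∑ α, B b (A.mode (u' α : V) 1 (A.mode (u α : V) 1 a))
        + B a (∑ α, B (u' α) b • (u α : V)) := by
    simp only [map_sum, ← Finset.sum_add_distrib]
    refine Finset.sum_congr rfl fun α _ => ?_
    have t := h.metric.mode_adjoint h.gr_one (h.mem_two (u' α)) 3 (A.mode b (-1) a) (u α)
    have t0 := h.metric.mode_adjoint h.gr_one (h.mem_two (u' α)) 2 (A.mode b 0 a) (u α)
    have t1 := h.metric.mode_adjoint h.gr_one ha2 1 (A.mode (u' α : V) 1 b) (u α)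
    have t2 := h.metric.mode_adjoint h.gr_one (h.mem_two (u' α)) 1 b (A.mode (u α : V) 1 a)
    norm_num at t t0 t1 t2
    rw [← t, h.mode_three_mode_neg_one ha2 hb2 (h.mem_two _)]
    simp only [map_add, LinearMap.add_apply, map_smul, LinearMap.smul_apply, smul_eq_mul]
    rw [t0, t1, h.metric.mode_one_comm h.gr_one ha2 (h.mem_two _), t2]
  have hs : ∑ α, B b (A.mode (u' α : V) 1 (A.mode (u α : V) 1 a)) = coefficient B u u' a b 1 := by
    rw [coefficient, show (2 : ℤ) - 1 = 1 by norm_num, ← h.sum_symm a b]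
    refine Finset.sum_congr rfl fun α _ => ?_
    have t1 := h.metric.mode_adjoint h.gr_one (h.mem_two (u' α)) 1 b (A.mode (u α : V) 1 a)
    have t2 := h.metric.mode_adjoint h.gr_one (h.mem_two (u α)) 1 a (A.mode (u' α : V) 1 b)
    norm_num at t1 t2
    rw [← t1, ← t2, h.metric.symm]
  have h0 : B (A.mode b 0 a) (A.mode A.conf 0 A.conf) = 4 * B a b := by
    have := h.metric.mode_adjoint h.gr_one A.conf_mem 2 (A.mode b 0 a) A.conf
    norm_num at this
    rw [← this, h.conf_mode_mode ha hb (by norm_num)]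
    norm_num [h.apply_mode_one_conf hb2]
    ring
  rw [hl, sum_dual_smul h.dual ha, sum_dual_smul h.dual hb, hs, h.sum_mode_zero, map_smul, h0,
    h.metric.symm b a, smul_eq_mul] at hr
  have hc := h.charge_ne_zero
  have hc' : 5 * A.charge + 22 ≠ 0 := fun h0 => h.charge_ne (by linear_combination h0 / 5)
  -- Cramer's rule for the coordinates of λ^{(4)}.
  have hx : x * (A.charge * (5 * A.charge + 22)) = 44 * p₂ := by
    linear_combination 5 * h2 - 6 * h3
  have hy : y * (5 * A.charge + 22) = 6 * p₂ := by
    refine mul_left_cancel₀ hc ?_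
    linear_combination (8 + A.charge) * h3 - 3 * h2
  have hz : 8 * p₂ / A.charge * A.charge = 8 * p₂ := div_mul_cancel₀ _ hc
  have hval : 8 * x + 6 * y - 8 * p₂ / A.charge
      = 4 * p₂ * (44 - A.charge) / (A.charge * (5 * A.charge + 22)) := by
    rw [eq_div_iff (mul_ne_zero hc hc')]
    linear_combination 8 * hx + 6 * A.charge * hy - (5 * A.charge + 22) * hz
  rw [← hval]
  linear_combination -hr

end CasimirData

end VertexOperatorAlgebra

/-! ### The trace on V_2 -/

namespace VertexOperatorAlgebra

variable {V : Type*} [AddCommGroup V] [Module ℂ V] {A : VertexOperatorAlgebra V}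
  {B : LinearMap.BilinForm ℂ V}

namespace CasimirData

variable {ι : Type*} [Fintype ι] [DecidableEq ι] {u u' : Module.Basis ι ℂ (A.primary 2)}

local notation "p₂" => (Module.finrank ℂ (A.primary 2) : ℂ)

/-- `V_2 = ℂω ⊕ P_2`. -/
theorem resolution_two (h : CasimirData A B u u') {c : V} (hc : c ∈ A.gr 2) :
    (2 / A.charge * B A.conf c) • A.conf + ∑ α, B (u' α) c • (u α : V) = c := by
  have hω : ∀ α, B (u' α) A.conf = 0 := fun α => by
    rw [h.metric.symm]
    exact ((h.metric.mem_primary_iff h.gr_one).mp (u' α).2).2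
  have hC := h.charge_ne_zero
  have hp : c - (2 / A.charge * B A.conf c) • A.conf ∈ A.primary 2 := by
    refine (h.metric.mem_primary_iff h.gr_one).mpr
      ⟨Submodule.sub_mem _ hc (Submodule.smul_mem _ _ A.conf_mem), ?_⟩
    rw [map_sub, map_smul, h.metric.apply_conf_conf h.gr_one, smul_eq_mul]
    field_simp
    ring
  have e := sum_dual_smul h.dual hp
  simp only [map_sub, map_smul, hω, smul_zero, sub_zero] at e
  rw [e]
  abel

/-- The resolution of the identity writes T as a sum of rank one maps, whose traces are evaluations.
-/
theorem trace_two (h : CasimirData A B u u') (T : Module.End ℂ (A.gr 2)) :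
    LinearMap.trace ℂ (A.gr 2) T
      = 2 / A.charge * B A.conf (T ⟨A.conf, A.conf_mem⟩)
        + ∑ α, B (u' α) (T ⟨u α, h.mem_two (u α)⟩) := by
  have hfin : ∀ k, FiniteDimensional ℂ (A.gr k) := A.finiteDimensional
  let f : V → A.gr 2 →ₗ[ℂ] ℂ := fun x => (B x).comp (A.gr 2).subtype
  have hT : T = ((2 / A.charge) • f A.conf).smulRight (T ⟨A.conf, A.conf_mem⟩)
      + ∑ α, (f (u' α)).smulRight (T ⟨u α, h.mem_two (u α)⟩) := by
    refine LinearMap.ext fun c => ?_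
    have hc : c = (2 / A.charge * B A.conf c) • (⟨A.conf, A.conf_mem⟩ : A.gr 2)
        + ∑ α, B (u' α) c • (⟨u α, h.mem_two (u α)⟩ : A.gr 2) := by
      refine Subtype.ext ?_
      rw [Submodule.coe_add, AddSubmonoidClass.coe_finsetSum]
      exact (h.resolution_two c.2).symm
    conv_lhs => rw [hc]
    simp only [map_add, map_smul, map_sum, LinearMap.add_apply, LinearMap.sum_apply,
      LinearMap.smulRight_apply, LinearMap.smul_apply, smul_eq_mul]
    rfl
  conv_lhs => rw [hT]
  rw [map_add, map_sum, LinearMap.trace_smulRight]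
  simp only [LinearMap.trace_smulRight]
  rfl

theorem trace_zeroMode_griess (h : CasimirData A B u u') (a b : A.gr 2) :
    LinearMap.trace ℂ (A.gr 2) (A.zeroMode 2 (A.griess a b))
      = 8 * (p₂ + 1) / A.charge * B a b := by
  set g : V := A.mode a 1 b with hg
  have hg2 : g ∈ A.gr 2 := A.mode_one_mem a.2 b.2
  have hzero : ∀ c : A.gr 2, ((A.zeroMode 2 (A.griess a b)) c : V) = A.mode g 1 c := fun c => rfl
  have hωg : B A.conf g = 2 * B a b := by
    rw [h.metric.symm, hg, h.metric.mode_one_comm h.gr_one a.2 b.2, h.apply_mode_one_conf b.2]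
  -- By commutativity and invariance, ⟨u^α, g_1 u_α⟩ = ⟨g, (u_α)_1 u^α⟩, and λ^{(2)} is a multiple
  -- of ω.
  have hsum : ∑ α, B (u' α) (A.mode g 1 (u α)) = 4 * p₂ / A.charge * B A.conf g := by
    rw [← smul_eq_mul, ← LinearMap.smul_apply, ← map_smul, ← h.sum_mode_one, ← h.sum_mode_symm,
      map_sum, LinearMap.sum_apply]
    refine Finset.sum_congr rfl fun α _ => ?_
    rw [h.metric.mode_one_comm h.gr_one hg2 (h.mem_two _),
      h.metric.mode_adjoint h.gr_one (h.mem_two (u α))]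
    norm_num
  rw [h.trace_two]
  simp only [hzero]
  rw [hsum, h.mode_one_conf hg2, map_smul, hωg, smul_eq_mul]
  ring

end CasimirData

end VertexOperatorAlgebra

/-! ### Coefficients in ℂ((x))((y)) -/

section LaurentCoefficients

theorem HahnSeries.coeff_C_mul_laurent {K : Type*} [Field K] (c : K) (F : LaurentSeries K)
    (k : ℤ) : (HahnSeries.C c * F).coeff k = c * F.coeff k := by
  rw [HahnSeries.C_mul_eq_smul, HahnSeries.coeff_smul, smul_eq_mul]

theorem HahnSeries.coeff_single_one_mul {K : Type*} [Field K] (F : LaurentSeries K) (k : ℤ) :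
    (HahnSeries.single 1 1 * F).coeff k = F.coeff (k - 1) := by
  rw [HahnSeries.coeff_single_mul, one_mul]

/-- The coefficient of `x^l y^k`. -/
def laurentCoeff (k l : ℤ) : LaurentSeries (LaurentSeries ℂ) →ₗ[ℂ] ℂ where
  toFun F := (F.coeff k).coeff l
  map_add' _ _ := rfl
  map_smul' _ _ := rfl

theorem laurentCoeff_smul (k l : ℤ) (c : ℂ) (F : LaurentSeries (LaurentSeries ℂ)) :
    laurentCoeff k l (c • F) = c * laurentCoeff k l F := rfl

theorem laurentCoeff_ext {F G : LaurentSeries (LaurentSeries ℂ)}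
    (h : ∀ k l, laurentCoeff k l F = laurentCoeff k l G) : F = G :=
  HahnSeries.ext (funext fun k => HahnSeries.ext (funext fun l => h k l))

theorem laurentCoeff_laurentX_mul (k l : ℤ) (F : LaurentSeries (LaurentSeries ℂ)) :
    laurentCoeff k l (laurentX * F) = laurentCoeff k (l - 1) F :=
  (congrArg (fun s => HahnSeries.coeff s l)
    (HahnSeries.coeff_C_mul_laurent (HahnSeries.single 1 1 : LaurentSeries ℂ) F k)).trans
    (HahnSeries.coeff_single_one_mul (F.coeff k) l)

theorem laurentCoeff_laurentY_mul (k l : ℤ) (F : LaurentSeries (LaurentSeries ℂ)) :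
    laurentCoeff k l (laurentY * F) = laurentCoeff (k - 1) l F :=
  congrArg (fun s => HahnSeries.coeff s l) (HahnSeries.coeff_single_one_mul F k)

theorem laurentCoeff_one (k l : ℤ) :
    laurentCoeff k l 1 = if k = 0 ∧ l = 0 then 1 else 0 := by
  have hK : ∀ {K : Type} [Field K] (k : ℤ),
      (1 : LaurentSeries K).coeff k = if k = 0 then 1 else 0 := fun k => by
    simp [HahnSeries.coeff_one]
  have h : laurentCoeff k l 1 = ((if k = 0 then (1 : LaurentSeries ℂ) else 0)).coeff l :=
    congrArg (fun s => HahnSeries.coeff s l) (hK k)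
  rw [h]
  by_cases hk : k = 0
  · simp only [hk, if_true, true_and]
    exact hK l
  · simp only [hk, if_false, false_and]
    rfl

theorem HahnSeries.algebraMap_laurent {K : Type*} [Field K] [Algebra ℂ K] (c : ℂ) :
    algebraMap ℂ (LaurentSeries K) c = HahnSeries.C (algebraMap ℂ K c) := by
  rw [HahnSeries.algebraMap_apply', PowerSeries.algebraMap_apply, HahnSeries.ofPowerSeries_C]

theorem HahnSeries.algebra_smul_laurent {K : Type*} [Field K] [Algebra ℂ K] (c : ℂ)
    (F : LaurentSeries K) (k : ℤ) :
    (algebraMap ℂ (LaurentSeries K) c * F).coeff k = algebraMap ℂ K c * F.coeff k := by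
  rw [HahnSeries.algebraMap_laurent, HahnSeries.coeff_C_mul_laurent]

end LaurentCoefficients

/-! ### From the coefficients to the rational function -/

section RationalFunction

theorem coef_monomial_mul {R : Type*} [CommRing R] {x y : R} {coef : ℤ → ℤ → R → ℂ}
    (hx : ∀ k l T, coef k l (x * T) = coef k (l - 1) T)
    (hy : ∀ k l T, coef k l (y * T) = coef (k - 1) l T) (i j : ℕ) (k l : ℤ) (T : R) :
    coef k l (x ^ i * y ^ j * T) = coef (k - j) (l - i) T := by
  have hxi : ∀ (i : ℕ) (l : ℤ) (T : R), coef k l (x ^ i * T) = coef k (l - i) T := by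
    intro i
    induction i with
    | zero => simp
    | succ i ih =>
      intro l T
      rw [pow_succ', mul_assoc, hx, ih, Nat.cast_succ, sub_sub, add_comm (1 : ℤ)]
  have hyj : ∀ (j : ℕ) (k l : ℤ) (T : R), coef k l (y ^ j * T) = coef (k - j) l T := by
    intro j
    induction j with
    | zero => simp
    | succ j ih =>
      intro k l T
      rw [pow_succ', mul_assoc, hy, ih, Nat.cast_succ, sub_sub, add_comm (1 : ℤ)]
  rw [mul_assoc, hxi, hyj]

variable {R : Type*} [Field R] [Algebra ℂ R] {x y : R} {coef : ℤ → ℤ → R → ℂ}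

/-- Every monomial carries a factor 1 so that `coef_monomial_mul` reads off its coefficients. -/
theorem griessPoly_expand (p C : ℂ) (x y : R) :
    griessPoly p C x y = x ^ 8 * y ^ 0 * 1 - (4 : ℂ) • (x ^ 7 * y ^ 1 * 1)
      + (4 * p * (44 - C) / (C * (5 * C + 22)) + 4) • (x ^ 6 * y ^ 2 * 1)
      + (8 * p / C - 4 * (4 * p * (44 - C) / (C * (5 * C + 22))) + 4) • (x ^ 5 * y ^ 3 * 1)
      + (p - 2 * (8 * p / C) + 6 * (4 * p * (44 - C) / (C * (5 * C + 22))) - 10)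
        • (x ^ 4 * y ^ 4 * 1)
      + (8 * p / C - 4 * (4 * p * (44 - C) / (C * (5 * C + 22))) + 4) • (x ^ 3 * y ^ 5 * 1)
      + (4 * p * (44 - C) / (C * (5 * C + 22)) + 4) • (x ^ 2 * y ^ 6 * 1)
      - (4 : ℂ) • (x ^ 1 * y ^ 7 * 1) + x ^ 0 * y ^ 8 * 1 := by
  rw [griessPoly]
  generalize 4 * p * (44 - C) / (C * (5 * C + 22)) = r
  generalize 8 * p / C = q
  simp only [Algebra.smul_def, map_add, map_sub, map_mul, map_ofNat]
  ring

/-- A series `∑_n f(n) x^{n-3} y^{-n-1}` whose coefficients satisfy a reflection formula with a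
cubic polynomial is the expansion of the corresponding rational function. -/
theorem eq_smul_griessPoly_div (hadd : ∀ k l S T, coef k l (S + T) = coef k l S + coef k l T)
    (hsmul : ∀ k l c T, coef k l (algebraMap ℂ R c * T) = c * coef k l T)
    (hext : ∀ S T : R, (∀ k l, coef k l S = coef k l T) → S = T)
    (hx : ∀ k l T, coef k l (x * T) = coef k (l - 1) T)
    (hy : ∀ k l T, coef k l (y * T) = coef (k - 1) l T)
    (h1 : ∀ k l, coef k l 1 = if k = 0 ∧ l = 0 then 1 else 0)
    {F G : R} {f : ℤ → ℂ} {β p C : ℂ}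
    (hG : ∀ k l, coef k l G = β * coef k l (griessPoly p C x y))
    (hF : ∀ k l, coef k l F = if k + l = -4 then f (-k - 1) else 0)
    (hf4 : ∀ n, 4 ≤ n → f n = 0) (hf2 : f 2 = 0) (hf3 : f 3 = β)
    (hf1 : f 1 = (4 * p * (44 - C) / (C * (5 * C + 22)) - 2) * β)
    (hf : ∀ m : ℤ, f (2 - m) = f m
      + β * (8 * p / C * (m - 1) + p * (m * (m - 1) * (m - 2) / 6))) :
    F = G / (x ^ 4 * y ^ 4 * (x - y) ^ 4) := by
  have hm := coef_monomial_mul hx hy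
  have h0 : ∀ k l, coef k l 0 = 0 := fun k l => by
    have := hadd k l 0 0
    simpa using this
  have hx0 : x ≠ 0 := by
    rintro rfl
    have := hx 0 1 1
    simp [h1, h0] at this
  have hy0 : y ≠ 0 := by
    rintro rfl
    have := hy 1 0 1
    simp [h1, h0] at this
  have hxy : x - y ≠ 0 := by
    intro h
    have := hx 0 1 1
    rw [sub_eq_zero.mp h, hy] at this
    simp [h1] at this
  rw [eq_div_iff (mul_ne_zero (mul_ne_zero (pow_ne_zero 4 hx0) (pow_ne_zero 4 hy0))
    (pow_ne_zero 4 hxy))]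
  have hexp : F * (x ^ 4 * y ^ 4 * (x - y) ^ 4) = x ^ 8 * y ^ 4 * F - (4 : ℂ) • (x ^ 7 * y ^ 5 * F)
      + (6 : ℂ) • (x ^ 6 * y ^ 6 * F) - (4 : ℂ) • (x ^ 5 * y ^ 7 * F) + x ^ 4 * y ^ 8 * F := by
    simp only [Algebra.smul_def, map_ofNat]
    ring
  rw [griessPoly_expand] at hG
  rw [hexp]
  simp only [Algebra.smul_def] at hG ⊢
  generalize hr : 4 * p * (44 - C) / (C * (5 * C + 22)) = r at *
  generalize hq : 8 * p / C = q at *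
  refine hext _ _ fun k l => ?_
  have hF' : ∀ i j : ℕ, i + j = 12 → coef (k - j) (l - i) F
      = if k + l = 8 then f (j - k - 1) else 0 := by
    intro i j hij
    have e1 : (k - (j : ℤ) + (l - i) = -4) = (k + l = 8) := propext (by omega)
    have e2 : -(k - (j : ℤ)) - 1 = j - k - 1 := by ring
    rw [hF, e2]
    simp only [e1]
  have h1' : ∀ i j : ℕ, i + j = 8 → coef (k - j) (l - i) 1
      = if k + l = 8 then (if k = j then 1 else 0) else 0 := by
    intro i j hij
    have e1 : (k - (j : ℤ) = 0 ∧ l - (i : ℤ) = 0) = (k + l = 8 ∧ k = j) := propext (by omega)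
    rw [h1, ← ite_and]
    simp only [e1]
  have hsub : ∀ S T, coef k l (S - T) = coef k l S - coef k l T := fun S T => by
    rw [sub_eq_add_neg, ← neg_one_smul ℂ T, Algebra.smul_def, hadd, hsmul]
    ring
  rw [hG]
  simp only [hadd, hsub, hsmul, hm]
  rw [hF' 8 4 rfl, hF' 7 5 rfl, hF' 6 6 rfl, hF' 5 7 rfl, hF' 4 8 rfl, h1' 8 0 rfl, h1' 7 1 rfl,
    h1' 6 2 rfl, h1' 5 3 rfl, h1' 4 4 rfl, h1' 3 5 rfl, h1' 2 6 rfl, h1' 1 7 rfl, h1' 0 8 rfl]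
  by_cases hkl : k + l = 8
  swap
  · simp [hkl]
  simp only [hkl, if_true]
  have hout : k < 0 ∨ 8 < k → ∀ j : ℕ, j ≤ 8 → (if k = j then (1 : ℂ) else 0) = 0 := fun hk j hj =>
    if_neg (by omega)
  -- For k < 0 all five indices of f are at least 4.
  rcases lt_or_ge k 0 with hk | hk
  · rw [hout (Or.inl hk) 0 (by norm_num), hout (Or.inl hk) 1 (by norm_num),
      hout (Or.inl hk) 2 (by norm_num), hout (Or.inl hk) 3 (by norm_num),
      hout (Or.inl hk) 4 (by norm_num), hout (Or.inl hk) 5 (by norm_num),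
      hout (Or.inl hk) 6 (by norm_num), hout (Or.inl hk) 7 (by norm_num),
      hout (Or.inl hk) 8 (by norm_num), hf4 _ (by omega), hf4 _ (by omega), hf4 _ (by omega),
      hf4 _ (by omega), hf4 _ (by omega)]
    ring
  rcases lt_or_ge 8 k with hk' | hk'
  -- For k > 8 the reflected indices are at least 4, so f is a cubic polynomial here and its fourth
  -- difference vanishes.
  · have hrefl : ∀ j : ℕ, j ≤ 8 → f (j - k - 1)
        = β * (q * ((k + 3 - j : ℂ) - 1)
          + p * ((k + 3 - j : ℂ) * ((k + 3 - j : ℂ) - 1) * ((k + 3 - j : ℂ) - 2) / 6)) := by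
      intro j hj
      have h := hf (k + 3 - j)
      rw [hf4 (k + 3 - j) (by omega), zero_add] at h
      have e : (j : ℤ) - k - 1 = 2 - (k + 3 - j) := by ring
      rw [e, h]
      push_cast
      ring
    rw [hout (Or.inr hk') 0 (by norm_num), hout (Or.inr hk') 1 (by norm_num),
      hout (Or.inr hk') 2 (by norm_num), hout (Or.inr hk') 3 (by norm_num),
      hout (Or.inr hk') 4 (by norm_num), hout (Or.inr hk') 5 (by norm_num),
      hout (Or.inr hk') 6 (by norm_num), hout (Or.inr hk') 7 (by norm_num),
      hout (Or.inr hk') 8 (by norm_num), hrefl 4 (by norm_num), hrefl 5 (by norm_num),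
      hrefl 6 (by norm_num), hrefl 7 (by norm_num), hrefl 8 (by norm_num)]
    push_cast
    ring
  -- For 0 ≤ k ≤ 8 the indices run from -5 to 7; reflection at 2, …, 7 gives the values at 0, …, -5.
  have f0 := hf 2
  have fm1 := hf 3
  have fm2 := hf 4
  have fm3 := hf 5
  have fm4 := hf 6
  have fm5 := hf 7
  have f4 := hf4 4 le_rfl
  have f5 := hf4 5 (by norm_num)
  have f6 := hf4 6 (by norm_num)
  have f7 := hf4 7 (by norm_num)
  norm_num [f4, f5, f6, f7, hf2, hf3] at f0 fm1 fm2 fm3 fm4 fm5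
  interval_cases k <;>
    norm_num [f4, f5, f6, f7, hf1, hf2, hf3, f0, fm1, fm2, fm3, fm4, fm5] <;> ring

end RationalFunction

/-! ### Assembly -/

section MainTheorem

namespace VertexOperatorAlgebra

variable {V : Type*} [AddCommGroup V] [Module ℂ V] {A : VertexOperatorAlgebra V}
  {B : LinearMap.BilinForm ℂ V}

/-- Distinct weight spaces are orthogonal. -/
theorem IsLiZMetric.apply_eq_zero (hB : A.IsLiZMetric B) (hV1 : A.gr 1 = ⊥) {k l : ℤ}
    (hkl : k ≠ l) {a b : V} (ha : a ∈ A.gr k) (hb : b ∈ A.gr l) : B a b = 0 := by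
  have h := hB.mode_adjoint hV1 A.conf_mem 1 a b
  have ha' : A.mode A.conf 1 a = (k : ℂ) • a := A.weight k a ha
  have hb' : A.mode A.conf (2 - 1) b = (l : ℂ) • b := A.weight l b hb
  rw [ha', hb', map_smul, map_smul, LinearMap.smul_apply, smul_eq_mul, smul_eq_mul,
    ← sub_eq_zero, ← sub_mul] at h
  exact (mul_eq_zero.mp h).resolve_left (sub_ne_zero.mpr (Int.cast_injective.ne hkl))

variable {ι : Type*} [Fintype ι] [DecidableEq ι] {u u' : Module.Basis ι ℂ (A.primary 2)}

/-- The coefficient of x^l y^k pairs a with a vector of weight k + l + 6, which is orthogonal to V_2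
unless k + l = -4. -/
theorem CasimirData.laurentCoeff_correlation (h : CasimirData A B u u') {a b : V}
    (ha : a ∈ A.primary 2) (hb : b ∈ A.primary 2) (k l : ℤ) :
    laurentCoeff k l (A.correlation B (fun α => (u α : V)) (fun α => (u' α : V)) a b)
      = if k + l = -4 then CasimirData.coefficient B u u' a b (-k - 1) else 0 := by
  have hc : ∀ α, laurentCoeff k l (A.twoPoint B a (u' α) (u α) b)
      = B a (A.mode (u' α : V) (-l - 1) (A.mode (u α : V) (-k - 1) b)) := by
    intro α
    have e := A.twoPoint_coeff B a (u' α) (u α) b (-l - 1) (-k - 1)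
    rw [show -(-k - 1) - 1 = k by ring, show -(-l - 1) - 1 = l by ring] at e
    exact e
  have hsum : laurentCoeff k l (A.correlation B (fun α => (u α : V)) (fun α => (u' α : V)) a b)
      = ∑ α, B a (A.mode (u' α : V) (-l - 1) (A.mode (u α : V) (-k - 1) b)) := by
    refine (map_sum (laurentCoeff k l) _ _).trans ?_
    exact Finset.sum_congr rfl fun α _ => hc α
  rw [hsum]
  split_ifs with hkl
  · have e : -l - 1 = 2 - (-k - 1) := by omega
    rw [e]
    rfl
  · refine Finset.sum_eq_zero fun α _ => ?_
    have h1 := A.mode_mem_two (h.mem_two (u α)) (h.mem_two ⟨b, hb⟩) (-k - 1)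
    have h2 := A.mode_mem' (h.mem_two (u' α)) h1 (-l - 1)
    exact h.metric.apply_eq_zero h.gr_one (by omega) (h.mem_two ⟨a, ha⟩) h2

theorem CasimirData.correlation_eq (h : CasimirData A B u u') {a b : V}
    (ha : a ∈ A.primary 2) (hb : b ∈ A.primary 2) :
    A.correlation B (fun α => (u α : V)) (fun α => (u' α : V)) a b
      = (B a b • griessPoly (Module.finrank ℂ (A.primary 2) : ℂ) A.charge laurentX laurentY)
        / (laurentX ^ 4 * laurentY ^ 4 * (laurentX - laurentY) ^ 4) := by
  refine eq_smul_griessPoly_div (R := LaurentSeries (LaurentSeries ℂ)) (x := laurentX)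
    (y := laurentY) (coef := fun k l F => laurentCoeff k l F)
    (f := CasimirData.coefficient B u u' a b) (β := B a b) (p := Module.finrank ℂ (A.primary 2))
    (C := A.charge) ?_ ?_ ?_ ?_ ?_ ?_ ?_ ?_ ?_ ?_ ?_ ?_ ?_
  · exact fun _ _ _ _ => rfl
  -- The scalar passes through the two layers of Laurent series in turn.
  · exact fun _ l c F => (congrArg (fun s => HahnSeries.coeff s l)
      (HahnSeries.algebra_smul_laurent (K := LaurentSeries ℂ) c F _)).trans
      (HahnSeries.algebra_smul_laurent (K := ℂ) c (F.coeff _) l)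
  · exact fun _ _ => laurentCoeff_ext
  · exact laurentCoeff_laurentX_mul
  · exact laurentCoeff_laurentY_mul
  · exact laurentCoeff_one
  · intro k l
    have e := laurentCoeff_smul k l (B a b)
      (griessPoly (Module.finrank ℂ (A.primary 2) : ℂ) A.charge laurentX laurentY)
    refine e.trans ?_
    rfl
  · exact h.laurentCoeff_correlation ha hb
  · exact fun _ => h.coefficient_of_four_le hb
  · exact h.coefficient_two hb
  · exact h.coefficient_three hb
  · exact h.coefficient_one ha hb
  · exact h.coefficient_reflect hb

end VertexOperatorAlgebra

end MainTheorem

end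

theorem mainTheorem12 {V : Type*} [AddCommGroup V] [Module ℂ V]
    (A : VertexOperatorAlgebra V) (B : LinearMap.BilinForm ℂ V) (hB : A.IsLiZMetric B)
    (hV1 : A.gr 1 = ⊥)
    {ι : Type*} [Fintype ι] [DecidableEq ι]
    (u u' : Module.Basis ι ℂ (A.primary 2))
    (hdual : ∀ α β : ι, B (u' α) (u β) = if α = β then 1 else 0)
    (hC0 : A.charge ≠ 0) (hC1 : A.charge ≠ -22 / 5)
    (hcas : A.casimir (fun α => (u α : V)) (fun α => (u' α : V)) 4 ∈ A.vacDescendants 4) :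
    (∀ a ∈ A.primary 2, ∀ b ∈ A.primary 2,
      A.correlation B (fun α => (u α : V)) (fun α => (u' α : V)) a b
        = (B a b • griessPoly (Module.finrank ℂ (A.primary 2) : ℂ) A.charge laurentX laurentY)
          / (laurentX ^ 4 * laurentY ^ 4 * (laurentX - laurentY) ^ 4)) ∧
    (∀ a b : A.gr 2,
      LinearMap.trace ℂ (A.gr 2) (A.zeroMode 2 (A.griess a b))
        = 8 * ((Module.finrank ℂ (A.primary 2) : ℂ) + 1) / A.charge * B a b) := by
  have h : VertexOperatorAlgebra.CasimirData A B u u' := ⟨hB, hV1, hdual, hC0, hC1, hcas⟩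
  exact ⟨fun a ha b hb => h.correlation_eq ha hb, h.trace_zeroMode_griess⟩
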